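/- Let $\mathcal G\rightrightarrows M$ be a (finite-dimensional, smooth) Lie groupoid with source $s$ and target $t$ (submersions), multiplication $m:\mathcal G^{(2)}\to\mathcal G$, $m(g,h)=gh$, defined on $\mathcal G^{(2)}=\{(g,h): s(g)=t(h)\}$, projections $p_1,p_2:\mathcal G^{(2)}\to\mathcal G$, inversion $i$, and units $1:M\to\mathcal G$, which are used to regard $T_xM$ as a subspace of $T_{1_x}\mathcal G$. Let $A_x=\ker(Ts)\subset T_{1_x}\mathcal G$ be the fibre of its Lie algebroid $A$ at $x\in M$. The *tangent groupoid* is $T\mathcal G\rightrightarrows TM$ with structure maps $Ts$, $Tt$, $T1$, $Ti$ and $Tm$; it induces componentwise, for every $n\ge 0$, a groupoid $\bigoplus^{n}T\mathcal G\rightrightarrows\bigoplus^{n}TM$ (for $n=0$ this is $\mathcal G\rightrightarrows M$). The *cotangent groupoid* is $T^*\mathcal G\rightrightarrows A^*$ with source and target $$\tilde s(\alpha_g)(u)=\alpha_g\big(Tl_g(u-Tt(u))\big)\ (u\in A_{s(g)}),\qquad \tilde t(\beta_g)(v)=\beta_g(Tr_g(v))\ (v\in A_{t(g)}),$$ where $l_g:t^{-1}(s(g))\to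 t^{-1}(t(g))$ and $r_g:s^{-1}(t(g))\to s^{-1}(s(g))$ are left and right multiplication by $g$, and with multiplication determined, for $\alpha_g,\beta_h$ with $\tilde s(\alpha_g)=\tilde t(\beta_h)$, by $$(\alpha_g\circ\beta_h)(Tm(X_g,Y_h))=\alpha_g(X_g)+\beta_h(Y_h),\qquad (X_g,Y_h)\in T_{(g,h)}\mathcal G^{(2)}.$$ Let $k\ge 1$ and let $\alpha\in\Omega^k(\mathcal G)$ be a smooth $k$-form. Let $$\alpha^\sharp:\textstyle\bigoplus^{k-1}T\mathcal G\to T^*\mathcal G,\qquad \alpha^\sharp(X_1,\dots,X_{k-1})=\alpha(X_1,\dots,X_{k-1},\,\cdot\,).$$ Then $\alpha$ is multiplicative, i.e. $m^*\alpha=p_1^*\alpha+p_2^*\alpha$ on $\mathcal G^{(2)}$, if and only if $\alpha^\sharp$ is a morphism of groupoids from $\bigoplus^{k-1}T\mathcal G\rightrightarrows\bigoplus^{k-1}TM$ to $T^*\mathcal G\rightrightarrows A^*$, i.e. there is a map $\bigoplus^{k-1}TM\to A^*$ of the objects over which $\alpha^\sharp$ is compatible with sources, targets, units and multiplications. -/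

import Mathlib

open scoped Manifold ContDiff Topology

section Velocity

variable {E : Type*} [NormedAddCommGroup E] [NormedSpace ℝ E]
  {M : Type*} [TopologicalSpace M] [ChartedSpace E M]
  {E' : Type*} [NormedAddCommGroup E'] [NormedSpace ℝ E']
  {M' : Type*} [TopologicalSpace M'] [ChartedSpace E' M']

/-- The curve `c` in the manifold `M` is differentiable at time `0`, with velocity `X`. -/
def HasVelocity (c : ℝ → M) (X : E) : Prop :=
  HasMFDerivAt 𝓘(ℝ, ℝ) 𝓘(ℝ, E) c 0
    (ContinuousLinearMap.toSpanSingleton ℝ X : ℝ →L[ℝ] E)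

theorem HasVelocity.unique {c c' : ℝ → M} {X X' : E} (h : HasVelocity c X)
    (h' : HasVelocity c' X') (he : c =ᶠ[𝓝 0] c') : X = X' := by
  have h1 : HasMFDerivAt 𝓘(ℝ, ℝ) 𝓘(ℝ, E) c 0
    (ContinuousLinearMap.toSpanSingleton ℝ X' : ℝ →L[ℝ] E) :=
    HasMFDerivAt.congr_of_eventuallyEq h' he
  have h2 := hasMFDerivAt_unique h h1
  have h3 : (ContinuousLinearMap.toSpanSingleton ℝ X : ℝ →L[ℝ] E) 1
    = (ContinuousLinearMap.toSpanSingleton ℝ X' : ℝ →L[ℝ] E) 1 :=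
    congrArg (fun L : ℝ →L[ℝ] E => L 1) h2
  simpa using h3

theorem HasVelocity.congr {c c' : ℝ → M} {X : E} (h : HasVelocity c X)
    (he : c' =ᶠ[𝓝 0] c) : HasVelocity c' X :=
  HasMFDerivAt.congr_of_eventuallyEq h he

theorem HasVelocity.comp_within {c : ℝ → M} {X : E} (h : HasVelocity c X)
    {f : M → M'} {S : Set M} {f' : E →L[ℝ] E'}
    (hf : HasMFDerivWithinAt 𝓘(ℝ, E) 𝓘(ℝ, E') f S (c 0) f')
    (hS : ∀ᶠ t in 𝓝 (0 : ℝ), c t ∈ S) : HasVelocity (fun t => f (c t)) (f' X) := by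
  have h1 : HasMFDerivWithinAt 𝓘(ℝ, ℝ) 𝓘(ℝ, E) c {t | c t ∈ S} 0
    (ContinuousLinearMap.toSpanSingleton ℝ X : ℝ →L[ℝ] E) :=
    HasMFDerivAt.hasMFDerivWithinAt h
  have h2 := (HasMFDerivWithinAt.comp (0 : ℝ) hf h1 (fun t ht => ht)).hasMFDerivAt hS
  have h3 : f'.comp (ContinuousLinearMap.toSpanSingleton ℝ X : ℝ →L[ℝ] E)
      = ContinuousLinearMap.toSpanSingleton ℝ (f' X) := by
    ext; simp
  unfold HasVelocity
  rw [← h3]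
  exact h2

theorem HasVelocity.comp {c : ℝ → M} {X : E} (h : HasVelocity c X)
    {f : M → M'} {f' : E →L[ℝ] E'}
    (hf : HasMFDerivAt 𝓘(ℝ, E) 𝓘(ℝ, E') f (c 0) f') :
    HasVelocity (fun t => f (c t)) (f' X) :=
  h.comp_within (S := Set.univ) hf.hasMFDerivWithinAt (by simp)

theorem hasVelocity_const (x : M) : HasVelocity (fun _ : ℝ => x) (0 : E) := by
  have h : HasMFDerivAt 𝓘(ℝ, ℝ) 𝓘(ℝ, E) (fun _ : ℝ => x) 0 0 := hasMFDerivAt_const x (0 : ℝ)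
  have h3 : (0 : ℝ →L[ℝ] E) = ContinuousLinearMap.toSpanSingleton ℝ (0 : E) := by
    ext; simp
  unfold HasVelocity
  rw [← h3]
  exact h

theorem hasVelocity_iff_hasDerivAt {c : ℝ → E} {X : E} : HasVelocity c X ↔ HasDerivAt c X 0 := by
  unfold HasVelocity
  rw [hasDerivAt_iff_hasFDerivAt]
  exact hasMFDerivAt_iff_hasFDerivAt

theorem exists_hasVelocity [IsManifold 𝓘(ℝ, E) ∞ M] (x : M) (X : E) :
    ∃ c : ℝ → M, c 0 = x ∧ HasVelocity c X := by
  have h1 : HasVelocity (fun t : ℝ => extChartAt 𝓘(ℝ, E) x x + t • X) X := by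
    rw [hasVelocity_iff_hasDerivAt]
    simpa using ((hasDerivAt_id (0 : ℝ)).smul_const X).const_add (extChartAt 𝓘(ℝ, E) x x)
  have h0 : extChartAt 𝓘(ℝ, E) x x + (0 : ℝ) • X = extChartAt 𝓘(ℝ, E) x x := by simp
  refine ⟨fun t => (extChartAt 𝓘(ℝ, E) x).symm (extChartAt 𝓘(ℝ, E) x x + t • X), by simp, ?_⟩
  have hd : HasMFDerivAt 𝓘(ℝ, E) 𝓘(ℝ, E) (extChartAt 𝓘(ℝ, E) x).symm
      (extChartAt 𝓘(ℝ, E) x x + (0 : ℝ) • X) (ContinuousLinearMap.id ℝ E) := by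
    rw [h0]
    have h2 := (mdifferentiableWithinAt_extChartAt_symm (I := 𝓘(ℝ, E))
      (mem_extChartAt_target (I := 𝓘(ℝ, E)) x)).hasMFDerivWithinAt
    rw [mfderivWithin_range_extChartAt_symm, modelWithCornersSelf_coe, Set.range_id] at h2
    exact hasMFDerivWithinAt_univ.1 h2
  exact h1.comp hd

/-- Curves lift through a submersion `f`, with any prescribed initial velocity `X` that `Tf` maps
to the velocity of the given curve. -/
theorem exists_lift [IsManifold 𝓘(ℝ, E) ∞ M] [IsManifold 𝓘(ℝ, E') ∞ M']
    {f : M → M'} {x : M} (hf : Manifold.IsSubmersionAt 𝓘(ℝ, E) 𝓘(ℝ, E') ∞ f x)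
    {γ : ℝ → M'} {Z : E'} (hγ0 : γ 0 = f x) (hγ : HasVelocity γ Z)
    {b : ℝ → M} {X : E} (hb0 : b 0 = x) (hb : HasVelocity b X) :
    ∃ (c : ℝ → M) (Y : E), c 0 = x ∧ HasVelocity c Y ∧ (∀ᶠ t in 𝓝 (0 : ℝ), f (c t) = γ t) ∧
      (mfderiv 𝓘(ℝ, E) 𝓘(ℝ, E') f x X = Z → Y = X) := by
  set φ := hf.domChart with hφ
  set ψ := hf.codChart with hψ
  set e := hf.equiv with he
  have hxφ : x ∈ φ.source := hf.mem_domChart_source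
  have hfψ : f x ∈ ψ.source := hf.mem_codChart_source
  have hW : ∀ y ∈ φ.target, ψ (f (φ.symm y)) = (e y).1 := by
    intro y hy
    have h1 : y ∈ (φ.extend 𝓘(ℝ, E)).target := by simpa using hy
    have h2 := hf.writtenInCharts h1
    simpa using h2
  obtain ⟨dφ, hφd⟩ : ∃ L : E →L[ℝ] E, HasMFDerivAt 𝓘(ℝ, E) 𝓘(ℝ, E) φ x L :=
    ⟨_, ((contMDiffAt_of_mem_maximalAtlas hf.domChart_mem_maximalAtlas
      hxφ).mdifferentiableAt (by simp)).hasMFDerivAt⟩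
  obtain ⟨dψ, hψd⟩ : ∃ L : E' →L[ℝ] E', HasMFDerivAt 𝓘(ℝ, E') 𝓘(ℝ, E') ψ (f x) L :=
    ⟨_, ((contMDiffAt_of_mem_maximalAtlas hf.codChart_mem_maximalAtlas
      hfψ).mdifferentiableAt (by simp)).hasMFDerivAt⟩
  obtain ⟨ds, hsd⟩ : ∃ L : E →L[ℝ] E, HasMFDerivAt 𝓘(ℝ, E) 𝓘(ℝ, E) φ.symm (φ x) L :=
    ⟨_, ((contMDiffAt_symm_of_mem_maximalAtlas hf.domChart_mem_maximalAtlas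
      (φ.map_source hxφ)).mdifferentiableAt (by simp)).hasMFDerivAt⟩
  have hfd : HasMFDerivAt 𝓘(ℝ, E) 𝓘(ℝ, E') f x (mfderiv 𝓘(ℝ, E) 𝓘(ℝ, E') f x) :=
    (hf.contMDiffAt.mdifferentiableAt (by simp)).hasMFDerivAt
  generalize (mfderiv 𝓘(ℝ, E) 𝓘(ℝ, E') f x : E →L[ℝ] E') = df at hfd ⊢
  subst hb0
  have hbc : ContinuousAt b 0 := hb.1
  have hγc : ContinuousAt γ 0 := hγ.1
  -- the three curves in coordinates
  have hB : HasVelocity (fun t => φ (b t)) (dφ X) := hb.comp hφd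
  have hΓ : HasVelocity (fun t => ψ (γ t)) (dψ Z) := hγ.comp (f := ψ) (by rw [hγ0]; exact hψd)
  have hF : HasVelocity (fun t => ψ (f (b t))) (dψ (df X)) :=
    (hb.comp hfd).comp hψd
  rw [hasVelocity_iff_hasDerivAt] at hB hΓ hF
  have hBsrc : ∀ᶠ t in 𝓝 (0 : ℝ), b t ∈ φ.source :=
    hbc.eventually (φ.open_source.mem_nhds hxφ)
  have hF' : HasDerivAt (fun t => ψ (f (b t))) (e (dφ X)).1 0 := by
    have h1 : HasDerivAt (fun t => (e (φ (b t))).1) (e (dφ X)).1 0 := by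
      have h2 := (((ContinuousLinearMap.fst ℝ E' hf.complement).comp
        (e : E →L[ℝ] E' × hf.complement)).hasFDerivAt (x := φ (b 0))).comp_hasDerivAt (0 : ℝ) hB
      exact h2
    refine h1.congr_of_eventuallyEq ?_
    filter_upwards [hBsrc] with t ht
    rw [← hW _ (φ.map_source ht), φ.left_inv ht]
  have hFe := hF.unique hF'
  let C : ℝ → E := fun t => e.symm (ψ (γ t), (e (φ (b t))).2)
  have hC : HasDerivAt C (e.symm (dψ Z, (e (dφ X)).2)) 0 := by
    have h2 : HasDerivAt (fun t => (e (φ (b t))).2) (e (dφ X)).2 0 := by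
      have h3 := (((ContinuousLinearMap.snd ℝ E' hf.complement).comp
        (e : E →L[ℝ] E' × hf.complement)).hasFDerivAt (x := φ (b 0))).comp_hasDerivAt (0 : ℝ) hB
      exact h3
    exact ((e.symm : _ →L[ℝ] E).hasFDerivAt
      (x := (ψ (γ 0), (e (φ (b 0))).2))).comp_hasDerivAt (0 : ℝ) (hΓ.prodMk h2)
  have hC0 : C 0 = φ (b 0) := by
    have h1 := hW _ (φ.map_source hxφ)
    rw [φ.left_inv hxφ, ← hγ0] at h1
    simp only [C, h1]
    exact e.symm_apply_apply _
  have hCt : ∀ᶠ t in 𝓝 (0 : ℝ), C t ∈ φ.target :=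
    hC.continuousAt.eventually (by rw [hC0]; exact φ.open_target.mem_nhds (φ.map_source hxφ))
  have hγs : ∀ᶠ t in 𝓝 (0 : ℝ), γ t ∈ ψ.source :=
    hγc.eventually (by rw [hγ0]; exact ψ.open_source.mem_nhds hfψ)
  have hsd' : HasMFDerivAt 𝓘(ℝ, E) 𝓘(ℝ, E) φ.symm (C 0) ds := by rw [hC0]; exact hsd
  have hBX : X = ds (dφ X) := by
    have h1 : HasVelocity (fun t => φ.symm (φ (b t))) (ds (dφ X)) :=
      (hasVelocity_iff_hasDerivAt.2 hB).comp hsd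
    refine hb.unique h1 ?_
    filter_upwards [hBsrc] with t ht
    rw [φ.left_inv ht]
  refine ⟨fun t => φ.symm (C t), ds (e.symm (dψ Z, (e (dφ X)).2)), ?_,
    (hasVelocity_iff_hasDerivAt.2 hC).comp hsd', ?_, ?_⟩
  · simp only [hC0]
    exact φ.left_inv hxφ
  · filter_upwards [hCt, hγs] with t h1 h2
    have h3 := hW _ h1
    have h4 : f (φ.symm (C t)) ∈ ψ.source :=
      hf.source_subset_preimage_source (φ.map_target h1)
    apply ψ.injOn h4 h2
    rw [h3]
    simp only [C]
    rw [e.apply_symm_apply]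
  · intro h
    refine Eq.trans ?_ hBX.symm
    congr 1
    rw [← h, hFe]
    exact e.symm_apply_apply _
end Velocity

theorem HasVelocity.prodMk {E : Type*} [NormedAddCommGroup E] [NormedSpace ℝ E]
    {M : Type*} [TopologicalSpace M] [ChartedSpace E M] {c c' : ℝ → M} {X Y : E}
    (h : HasVelocity c X) (h' : HasVelocity c' Y) :
    HasMFDerivAt 𝓘(ℝ, ℝ) (𝓘(ℝ, E).prod 𝓘(ℝ, E)) (fun t => (c t, c' t)) 0
      (ContinuousLinearMap.toSpanSingleton ℝ (X, Y) : ℝ →L[ℝ] E × E) := by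
  have h3 : (ContinuousLinearMap.toSpanSingleton ℝ (X, Y) : ℝ →L[ℝ] E × E)
      = (ContinuousLinearMap.toSpanSingleton ℝ X).prod (ContinuousLinearMap.toSpanSingleton ℝ Y) := by
    ext <;> simp
  rw [h3]
  exact HasMFDerivAt.prodMk h h'

/-- A groupoid with set of arrows `G` and set of objects `M`, arrows `g`, `h` being composable when
`src g = tgt h`. The multiplication is recorded as a total map; only its values on composable pairs
are meaningful. -/
structure SetGroupoid (G M : Type*) where
  src : G → M
  tgt : G → M
  one : M → G
  inv : G → G
  mul : G → G → G
  src_one : ∀ x, src (one x) = x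
  tgt_one : ∀ x, tgt (one x) = x
  src_inv : ∀ g, src (inv g) = tgt g
  tgt_inv : ∀ g, tgt (inv g) = src g
  src_mul : ∀ g h, src g = tgt h → src (mul g h) = src h
  tgt_mul : ∀ g h, src g = tgt h → tgt (mul g h) = tgt g
  mul_assoc : ∀ g h k, src g = tgt h → src h = tgt k → mul (mul g h) k = mul g (mul h k)
  mul_one : ∀ g, mul g (one (src g)) = g
  one_mul : ∀ g, mul (one (tgt g)) g = g
  inv_mul : ∀ g, mul (inv g) g = one (src g)
  mul_inv : ∀ g, mul g (inv g) = one (tgt g)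

namespace SetGroupoid

/-- The set `G⁽²⁾` of composable pairs. -/
def composable {G M : Type*} (Γ : SetGroupoid G M) : Set (G × G) :=
  {p | Γ.src p.1 = Γ.tgt p.2}

/-- `F : G₁ → G₂` is a groupoid morphism: over some map `f` of the objects, it preserves sources,
targets, units and products. -/
def IsMorphism {G₁ M₁ G₂ M₂ : Type*} (Γ₁ : SetGroupoid G₁ M₁) (Γ₂ : SetGroupoid G₂ M₂)
    (F : G₁ → G₂) : Prop :=
  ∃ f : M₁ → M₂,
    (∀ a, Γ₂.src (F a) = f (Γ₁.src a)) ∧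
    (∀ a, Γ₂.tgt (F a) = f (Γ₁.tgt a)) ∧
    (∀ x, F (Γ₁.one x) = Γ₂.one (f x)) ∧
    (∀ a b, Γ₁.src a = Γ₁.tgt b → F (Γ₁.mul a b) = Γ₂.mul (F a) (F b))

end SetGroupoid

/-- A (finite-dimensional, smooth) Lie groupoid `G` over `M`: source and target are submersions, so
that `G⁽²⁾` is a submanifold of `G × G`, and all structure maps are smooth. -/
structure LieGroupoid (EG EM G M : Type*) [NormedAddCommGroup EG] [NormedSpace ℝ EG]
    [NormedAddCommGroup EM] [NormedSpace ℝ EM] [TopologicalSpace G] [ChartedSpace EG G]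
    [TopologicalSpace M] [ChartedSpace EM M]
    [FiniteDimensional ℝ EG] [FiniteDimensional ℝ EM]
    [IsManifold 𝓘(ℝ, EG) ∞ G] [IsManifold 𝓘(ℝ, EM) ∞ M] extends SetGroupoid G M where
  isSubmersion_src : Manifold.IsSubmersion 𝓘(ℝ, EG) 𝓘(ℝ, EM) ∞ src
  isSubmersion_tgt : Manifold.IsSubmersion 𝓘(ℝ, EG) 𝓘(ℝ, EM) ∞ tgt
  contMDiff_one : ContMDiff 𝓘(ℝ, EM) 𝓘(ℝ, EG) ∞ one
  contMDiff_inv : ContMDiff 𝓘(ℝ, EG) 𝓘(ℝ, EG) ∞ inv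
  contMDiffOn_mul : ContMDiffOn (𝓘(ℝ, EG).prod 𝓘(ℝ, EG)) 𝓘(ℝ, EG) ∞
    (fun p : G × G => mul p.1 p.2) toSetGroupoid.composable

namespace LieGroupoid

variable {EG EM G M : Type*} [NormedAddCommGroup EG] [NormedSpace ℝ EG]
    [NormedAddCommGroup EM] [NormedSpace ℝ EM] [TopologicalSpace G] [ChartedSpace EG G]
    [TopologicalSpace M] [ChartedSpace EM M]
    [FiniteDimensional ℝ EG] [FiniteDimensional ℝ EM]
    [IsManifold 𝓘(ℝ, EG) ∞ G] [IsManifold 𝓘(ℝ, EM) ∞ M]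

section TangentMaps

variable (𝒢 : LieGroupoid EG EM G M)

/-- The differential `Ts : T_g G → T_{s(g)} M`. (`TangentSpace` is the model space at each point.) -/
noncomputable def Tsrc (g : G) : EG →L[ℝ] EM := mfderiv 𝓘(ℝ, EG) 𝓘(ℝ, EM) 𝒢.src g

/-- The differential `Tt : T_g G → T_{t(g)} M`. -/
noncomputable def Ttgt (g : G) : EG →L[ℝ] EM := mfderiv 𝓘(ℝ, EG) 𝓘(ℝ, EM) 𝒢.tgt g

/-- The differential `T_x M → T_{1_x} G` of the unit map. -/
noncomputable def Tone (x : M) : EM →L[ℝ] EG := mfderiv 𝓘(ℝ, EM) 𝓘(ℝ, EG) 𝒢.one x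

/-- The differential `T_g G → T_{g⁻¹} G` of the inversion. -/
noncomputable def Tinv (g : G) : EG →L[ℝ] EG := mfderiv 𝓘(ℝ, EG) 𝓘(ℝ, EG) 𝒢.inv g

/-- The differential `Tm` at `(g, h)` of the multiplication `m : G⁽²⁾ → G`. Only its values on the
tangent vectors `(X, Y)` of `G⁽²⁾`, that is, those with `Ts X = Tt Y`, are meaningful. -/
noncomputable def Tmul (g h : G) : EG × EG →L[ℝ] EG :=
  mfderivWithin (𝓘(ℝ, EG).prod 𝓘(ℝ, EG)) 𝓘(ℝ, EG) (fun p : G × G => 𝒢.mul p.1 p.2)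
    𝒢.composable (g, h)

/-- The differential at `1_{s(g)}` of the left multiplication `l_g : t⁻¹(s(g)) → t⁻¹(t(g))`; only
its values on the tangent space `Ker Tt` of the fibre are meaningful. -/
noncomputable def Tleft (g : G) : EG →L[ℝ] EG :=
  mfderivWithin 𝓘(ℝ, EG) 𝓘(ℝ, EG) (fun h : G => 𝒢.mul g h) {h | 𝒢.tgt h = 𝒢.src g}
    (𝒢.one (𝒢.src g))

/-- The differential at `1_{t(g)}` of the right multiplication `r_g : s⁻¹(t(g)) → s⁻¹(s(g))`; only
its values on the tangent space `Ker Ts` of the fibre are meaningful. -/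
noncomputable def Tright (g : G) : EG →L[ℝ] EG :=
  mfderivWithin 𝓘(ℝ, EG) 𝓘(ℝ, EG) (fun h : G => 𝒢.mul h g) {h | 𝒢.src h = 𝒢.tgt g}
    (𝒢.one (𝒢.tgt g))

/-- The fibre `A_x = Ker (Ts) ⊆ T_{1_x} G` of the Lie algebroid. -/
noncomputable def algebroidFibre (x : M) : Submodule ℝ EG :=
  LinearMap.ker (𝒢.Tsrc (𝒢.one x)).toLinearMap

theorem velocity_src {c : ℝ → G} {X : EG} (h : HasVelocity c X) :
    HasVelocity (fun t => 𝒢.src (c t)) (𝒢.Tsrc (c 0) X) :=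
  h.comp (𝒢.isSubmersion_src.contMDiff.mdifferentiableAt (by simp)).hasMFDerivAt

theorem velocity_tgt {c : ℝ → G} {X : EG} (h : HasVelocity c X) :
    HasVelocity (fun t => 𝒢.tgt (c t)) (𝒢.Ttgt (c 0) X) :=
  h.comp (𝒢.isSubmersion_tgt.contMDiff.mdifferentiableAt (by simp)).hasMFDerivAt

theorem velocity_one {c : ℝ → M} {X : EM} (h : HasVelocity c X) :
    HasVelocity (fun t => 𝒢.one (c t)) (𝒢.Tone (c 0) X) :=
  h.comp (𝒢.contMDiff_one.mdifferentiableAt (by simp)).hasMFDerivAt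

theorem velocity_inv {c : ℝ → G} {X : EG} (h : HasVelocity c X) :
    HasVelocity (fun t => 𝒢.inv (c t)) (𝒢.Tinv (c 0) X) :=
  h.comp (𝒢.contMDiff_inv.mdifferentiableAt (by simp)).hasMFDerivAt

theorem velocity_mul {c c' : ℝ → G} {X Y : EG} (h : HasVelocity c X) (h' : HasVelocity c' Y)
    (hc : ∀ᶠ t in 𝓝 (0 : ℝ), 𝒢.src (c t) = 𝒢.tgt (c' t)) :
    HasVelocity (fun t => 𝒢.mul (c t) (c' t)) (𝒢.Tmul (c 0) (c' 0) (X, Y)) := by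
  have hm : HasMFDerivWithinAt (𝓘(ℝ, EG).prod 𝓘(ℝ, EG)) 𝓘(ℝ, EG)
      (fun p : G × G => 𝒢.mul p.1 p.2) 𝒢.composable (c 0, c' 0) (𝒢.Tmul (c 0) (c' 0)) :=
    ((𝒢.contMDiffOn_mul (c 0, c' 0) hc.self_of_nhds).mdifferentiableWithinAt
      (by simp)).hasMFDerivWithinAt
  have h1 : HasMFDerivWithinAt 𝓘(ℝ, ℝ) (𝓘(ℝ, EG).prod 𝓘(ℝ, EG)) (fun t => (c t, c' t))
      {t | 𝒢.src (c t) = 𝒢.tgt (c' t)} 0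
      (ContinuousLinearMap.toSpanSingleton ℝ (X, Y) : ℝ →L[ℝ] EG × EG) :=
    HasMFDerivAt.hasMFDerivWithinAt (h.prodMk h')
  have h2 := (HasMFDerivWithinAt.comp (0 : ℝ) (u := 𝒢.composable) hm h1
    (fun t ht => ht)).hasMFDerivAt hc
  have h3 : (𝒢.Tmul (c 0) (c' 0)).comp
      (ContinuousLinearMap.toSpanSingleton ℝ (X, Y) : ℝ →L[ℝ] EG × EG)
      = ContinuousLinearMap.toSpanSingleton ℝ (𝒢.Tmul (c 0) (c' 0) (X, Y)) := by
    ext; simp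
  unfold HasVelocity
  rw [← h3]
  exact h2

theorem exists_curve_tgt {γ : ℝ → M} {Z : EM} (hγ : HasVelocity γ Z) (h : G)
    (h0 : γ 0 = 𝒢.tgt h) (Y : EG) (hY : 𝒢.Ttgt h Y = Z) :
    ∃ b : ℝ → G, b 0 = h ∧ HasVelocity b Y ∧ ∀ᶠ t in 𝓝 (0 : ℝ), 𝒢.tgt (b t) = γ t := by
  obtain ⟨b, hb0, hb⟩ := exists_hasVelocity h Y
  obtain ⟨c, Y', hc0, hc, hl, hY'⟩ :=
    exists_lift (𝒢.isSubmersion_tgt.isSubmersionAt h) h0 hγ hb0 hb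
  obtain rfl := hY' hY
  exact ⟨c, hc0, hc, hl⟩

theorem exists_curve_src {γ : ℝ → M} {Z : EM} (hγ : HasVelocity γ Z) (h : G)
    (h0 : γ 0 = 𝒢.src h) (Y : EG) (hY : 𝒢.Tsrc h Y = Z) :
    ∃ b : ℝ → G, b 0 = h ∧ HasVelocity b Y ∧ ∀ᶠ t in 𝓝 (0 : ℝ), 𝒢.src (b t) = γ t := by
  obtain ⟨b, hb0, hb⟩ := exists_hasVelocity h Y
  obtain ⟨c, Y', hc0, hc, hl, hY'⟩ :=
    exists_lift (𝒢.isSubmersion_src.isSubmersionAt h) h0 hγ hb0 hb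
  obtain rfl := hY' hY
  exact ⟨c, hc0, hc, hl⟩

theorem exists_curves {g h : G} {X Y : EG} (hgh : 𝒢.src g = 𝒢.tgt h)
    (hXY : 𝒢.Tsrc g X = 𝒢.Ttgt h Y) :
    ∃ a b : ℝ → G, a 0 = g ∧ b 0 = h ∧ HasVelocity a X ∧ HasVelocity b Y ∧
      ∀ᶠ t in 𝓝 (0 : ℝ), 𝒢.src (a t) = 𝒢.tgt (b t) := by
  obtain ⟨a, rfl, ha⟩ := exists_hasVelocity g X
  obtain ⟨b, hb0, hb, hl⟩ := 𝒢.exists_curve_tgt (𝒢.velocity_src ha) h hgh Y hXY.symm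
  exact ⟨a, b, rfl, hb0, ha, hb, hl.mono fun t ht => ht.symm⟩

theorem Tsrc_surjective (g : G) : Function.Surjective (𝒢.Tsrc g) := by
  intro Z
  obtain ⟨γ, hγ0, hγ⟩ := exists_hasVelocity (𝒢.src g) Z
  obtain ⟨c, Y, rfl, hc, hl, -⟩ := exists_lift (𝒢.isSubmersion_src.isSubmersionAt g) hγ0 hγ
    (b := fun _ => g) rfl (hasVelocity_const (E := EG) g)
  exact ⟨Y, (𝒢.velocity_src hc).unique hγ hl⟩

theorem Tsrc_Tmul {g h : G} {X Y : EG} (hgh : 𝒢.src g = 𝒢.tgt h)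
    (hXY : 𝒢.Tsrc g X = 𝒢.Ttgt h Y) :
    𝒢.Tsrc (𝒢.mul g h) (𝒢.Tmul g h (X, Y)) = 𝒢.Tsrc h Y := by
  obtain ⟨a, b, rfl, rfl, ha, hb, hl⟩ := 𝒢.exists_curves hgh hXY
  refine (𝒢.velocity_src (𝒢.velocity_mul ha hb hl)).unique (𝒢.velocity_src hb) ?_
  filter_upwards [hl] with t ht
  exact 𝒢.src_mul _ _ ht

theorem Ttgt_Tmul {g h : G} {X Y : EG} (hgh : 𝒢.src g = 𝒢.tgt h)
    (hXY : 𝒢.Tsrc g X = 𝒢.Ttgt h Y) :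
    𝒢.Ttgt (𝒢.mul g h) (𝒢.Tmul g h (X, Y)) = 𝒢.Ttgt g X := by
  obtain ⟨a, b, rfl, rfl, ha, hb, hl⟩ := 𝒢.exists_curves hgh hXY
  refine (𝒢.velocity_tgt (𝒢.velocity_mul ha hb hl)).unique (𝒢.velocity_tgt ha) ?_
  filter_upwards [hl] with t ht
  exact 𝒢.tgt_mul _ _ ht

theorem Tmul_assoc {g h k : G} {X Y Z : EG} (hgh : 𝒢.src g = 𝒢.tgt h)
    (hhk : 𝒢.src h = 𝒢.tgt k) (hXY : 𝒢.Tsrc g X = 𝒢.Ttgt h Y) (hYZ : 𝒢.Tsrc h Y = 𝒢.Ttgt k Z) :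
    𝒢.Tmul (𝒢.mul g h) k (𝒢.Tmul g h (X, Y), Z) =
      𝒢.Tmul g (𝒢.mul h k) (X, 𝒢.Tmul h k (Y, Z)) := by
  obtain ⟨a, b, rfl, rfl, ha, hb, hl⟩ := 𝒢.exists_curves hgh hXY
  obtain ⟨c, rfl, hc, hm⟩ := 𝒢.exists_curve_tgt (𝒢.velocity_src hb) k hhk Z hYZ.symm
  have hm' : ∀ᶠ t in 𝓝 (0 : ℝ), 𝒢.src (b t) = 𝒢.tgt (c t) := hm.mono fun t ht => ht.symm
  refine (𝒢.velocity_mul (𝒢.velocity_mul ha hb hl) hc ?_).unique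
    (𝒢.velocity_mul ha (𝒢.velocity_mul hb hc hm') ?_) ?_
  · filter_upwards [hl, hm'] with t h1 h2
    rw [𝒢.src_mul _ _ h1, h2]
  · filter_upwards [hl, hm'] with t h1 h2
    rw [𝒢.tgt_mul _ _ h2, h1]
  · filter_upwards [hl, hm'] with t h1 h2
    exact 𝒢.mul_assoc _ _ _ h1 h2

theorem Tsrc_Tone (x : M) (Z : EM) : 𝒢.Tsrc (𝒢.one x) (𝒢.Tone x Z) = Z := by
  obtain ⟨γ, rfl, hγ⟩ := exists_hasVelocity x Z
  exact (𝒢.velocity_src (𝒢.velocity_one hγ)).unique hγ (.of_forall fun t => 𝒢.src_one _)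

theorem Ttgt_Tone (x : M) (Z : EM) : 𝒢.Ttgt (𝒢.one x) (𝒢.Tone x Z) = Z := by
  obtain ⟨γ, rfl, hγ⟩ := exists_hasVelocity x Z
  exact (𝒢.velocity_tgt (𝒢.velocity_one hγ)).unique hγ (.of_forall fun t => 𝒢.tgt_one _)

theorem Tsrc_Tinv (g : G) (X : EG) : 𝒢.Tsrc (𝒢.inv g) (𝒢.Tinv g X) = 𝒢.Ttgt g X := by
  obtain ⟨a, rfl, ha⟩ := exists_hasVelocity g X
  exact (𝒢.velocity_src (𝒢.velocity_inv ha)).unique (𝒢.velocity_tgt ha)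
    (.of_forall fun t => 𝒢.src_inv _)

theorem Ttgt_Tinv (g : G) (X : EG) : 𝒢.Ttgt (𝒢.inv g) (𝒢.Tinv g X) = 𝒢.Tsrc g X := by
  obtain ⟨a, rfl, ha⟩ := exists_hasVelocity g X
  exact (𝒢.velocity_tgt (𝒢.velocity_inv ha)).unique (𝒢.velocity_src ha)
    (.of_forall fun t => 𝒢.tgt_inv _)

theorem Tmul_Tone (g : G) (X : EG) :
    𝒢.Tmul g (𝒢.one (𝒢.src g)) (X, 𝒢.Tone (𝒢.src g) (𝒢.Tsrc g X)) = X := by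
  obtain ⟨a, rfl, ha⟩ := exists_hasVelocity g X
  exact (𝒢.velocity_mul ha (𝒢.velocity_one (𝒢.velocity_src ha))
    (.of_forall fun t => (𝒢.tgt_one _).symm)).unique ha (.of_forall fun t => 𝒢.mul_one _)

theorem Tone_Tmul (g : G) (X : EG) :
    𝒢.Tmul (𝒢.one (𝒢.tgt g)) g (𝒢.Tone (𝒢.tgt g) (𝒢.Ttgt g X), X) = X := by
  obtain ⟨a, rfl, ha⟩ := exists_hasVelocity g X
  exact (𝒢.velocity_mul (𝒢.velocity_one (𝒢.velocity_tgt ha)) ha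
    (.of_forall fun t => 𝒢.src_one _)).unique ha (.of_forall fun t => 𝒢.one_mul _)

theorem Tinv_Tmul (g : G) (X : EG) :
    𝒢.Tmul (𝒢.inv g) g (𝒢.Tinv g X, X) = 𝒢.Tone (𝒢.src g) (𝒢.Tsrc g X) := by
  obtain ⟨a, rfl, ha⟩ := exists_hasVelocity g X
  exact (𝒢.velocity_mul (𝒢.velocity_inv ha) ha (.of_forall fun t => 𝒢.src_inv _)).unique
    (𝒢.velocity_one (𝒢.velocity_src ha)) (.of_forall fun t => 𝒢.inv_mul _)

theorem Tmul_Tinv (g : G) (X : EG) :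
    𝒢.Tmul g (𝒢.inv g) (X, 𝒢.Tinv g X) = 𝒢.Tone (𝒢.tgt g) (𝒢.Ttgt g X) := by
  obtain ⟨a, rfl, ha⟩ := exists_hasVelocity g X
  exact (𝒢.velocity_mul ha (𝒢.velocity_inv ha) (.of_forall fun t => (𝒢.tgt_inv _).symm)).unique
    (𝒢.velocity_one (𝒢.velocity_tgt ha)) (.of_forall fun t => 𝒢.mul_inv _)

theorem Tright_apply (g : G) {v : EG} (hv : 𝒢.Tsrc (𝒢.one (𝒢.tgt g)) v = 0) :
    𝒢.Tright g v = 𝒢.Tmul (𝒢.one (𝒢.tgt g)) g (v, 0) := by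
  have hs : 𝒢.src (𝒢.one (𝒢.tgt g)) = 𝒢.tgt g := 𝒢.src_one _
  obtain ⟨b, hb0, hb, hl⟩ := 𝒢.exists_curve_src (hasVelocity_const (E := EM) (𝒢.tgt g))
    (𝒢.one (𝒢.tgt g)) hs.symm v hv
  have h1 := 𝒢.velocity_mul hb (hasVelocity_const (E := EG) g) hl
  have hd : MDifferentiableWithinAt 𝓘(ℝ, EG) 𝓘(ℝ, EG) (fun h : G => 𝒢.mul h g)
      {h | 𝒢.src h = 𝒢.tgt g} (𝒢.one (𝒢.tgt g)) := by
    have h2 : MDifferentiableWithinAt (𝓘(ℝ, EG).prod 𝓘(ℝ, EG)) 𝓘(ℝ, EG)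
        (fun p : G × G => 𝒢.mul p.1 p.2) 𝒢.composable (𝒢.one (𝒢.tgt g), g) :=
      (𝒢.contMDiffOn_mul _ hs).mdifferentiableWithinAt (by simp)
    exact h2.comp (𝒢.one (𝒢.tgt g))
      (mdifferentiableAt_id.prodMk mdifferentiableAt_const).mdifferentiableWithinAt
      (fun h hh => hh)
  have h2 := hb.comp_within (f' := 𝒢.Tright g) (by rw [hb0]; exact hd.hasMFDerivWithinAt) hl
  rw [← hb0]
  exact h2.unique h1 (.of_forall fun t => rfl)

theorem Tleft_apply (g : G) {v : EG} (hv : 𝒢.Ttgt (𝒢.one (𝒢.src g)) v = 0) :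
    𝒢.Tleft g v = 𝒢.Tmul g (𝒢.one (𝒢.src g)) (0, v) := by
  have hs : 𝒢.tgt (𝒢.one (𝒢.src g)) = 𝒢.src g := 𝒢.tgt_one _
  obtain ⟨b, hb0, hb, hl⟩ := 𝒢.exists_curve_tgt (hasVelocity_const (E := EM) (𝒢.src g))
    (𝒢.one (𝒢.src g)) hs.symm v hv
  have h1 := 𝒢.velocity_mul (hasVelocity_const (E := EG) g) hb (hl.mono fun t ht => ht.symm)
  have hd : MDifferentiableWithinAt 𝓘(ℝ, EG) 𝓘(ℝ, EG) (fun h : G => 𝒢.mul g h)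
      {h | 𝒢.tgt h = 𝒢.src g} (𝒢.one (𝒢.src g)) := by
    have h2 : MDifferentiableWithinAt (𝓘(ℝ, EG).prod 𝓘(ℝ, EG)) 𝓘(ℝ, EG)
        (fun p : G × G => 𝒢.mul p.1 p.2) 𝒢.composable (g, 𝒢.one (𝒢.src g)) :=
      (𝒢.contMDiffOn_mul _ hs.symm).mdifferentiableWithinAt (by simp)
    exact h2.comp (𝒢.one (𝒢.src g))
      (mdifferentiableAt_const.prodMk mdifferentiableAt_id).mdifferentiableWithinAt
      (fun h hh => Eq.symm hh)
  have h2 := hb.comp_within (f' := 𝒢.Tleft g) (by rw [hb0]; exact hd.hasMFDerivWithinAt) hl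
  rw [← hb0]
  exact h2.unique h1 (.of_forall fun t => rfl)

theorem mem_algebroidFibre {x : M} {v : EG} :
    v ∈ 𝒢.algebroidFibre x ↔ 𝒢.Tsrc (𝒢.one x) v = 0 := Iff.rfl

end TangentMaps

section TangentGroupoid

variable (𝒢 : LieGroupoid EG EM G M)

theorem tangentPower_ext {E N : Type*} [NormedAddCommGroup E] [NormedSpace ℝ E]
    [TopologicalSpace N] [ChartedSpace E N] {k : ℕ}
    {a b : Σ x : N, Fin k → TangentSpace 𝓘(ℝ, E) x}
    (h1 : a.1 = b.1) (h2 : ∀ i, (a.2 i : E) = b.2 i) : a = b := by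
  obtain ⟨x, a⟩ := a
  obtain ⟨y, b⟩ := b
  obtain rfl : x = y := h1
  congr 1
  exact funext h2

theorem tangentPower_eq {E N : Type*} [NormedAddCommGroup E] [NormedSpace ℝ E]
    [TopologicalSpace N] [ChartedSpace E N] {k : ℕ}
    {a b : Σ x : N, Fin k → TangentSpace 𝓘(ℝ, E) x} (h : a = b) (i : Fin k) :
    (a.2 i : E) = b.2 i := by
  subst h; rfl

/-- The groupoid `⊕ᵏ TG` over `⊕ᵏ TM`, with componentwise structure maps induced by those of the
tangent groupoid `TG` over `TM` (which is the case `k = 1`). For `k = 0` it is `G` over `M`. -/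
noncomputable def tangentGroupoid (k : ℕ) :
    SetGroupoid (Σ g : G, Fin k → TangentSpace 𝓘(ℝ, EG) g)
      (Σ x : M, Fin k → TangentSpace 𝓘(ℝ, EM) x) where
  src a := ⟨𝒢.src a.1, fun i => 𝒢.Tsrc a.1 (a.2 i)⟩
  tgt a := ⟨𝒢.tgt a.1, fun i => 𝒢.Ttgt a.1 (a.2 i)⟩
  one z := ⟨𝒢.one z.1, fun i => 𝒢.Tone z.1 (z.2 i)⟩
  inv a := ⟨𝒢.inv a.1, fun i => 𝒢.Tinv a.1 (a.2 i)⟩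
  mul a b := ⟨𝒢.mul a.1 b.1, fun i => 𝒢.Tmul a.1 b.1 (a.2 i, b.2 i)⟩
  src_one _ := tangentPower_ext (𝒢.src_one _) fun _ => 𝒢.Tsrc_Tone _ _
  tgt_one _ := tangentPower_ext (𝒢.tgt_one _) fun _ => 𝒢.Ttgt_Tone _ _
  src_inv _ := tangentPower_ext (𝒢.src_inv _) fun _ => 𝒢.Tsrc_Tinv _ _
  tgt_inv _ := tangentPower_ext (𝒢.tgt_inv _) fun _ => 𝒢.Ttgt_Tinv _ _
  src_mul _ _ h := tangentPower_ext (𝒢.src_mul _ _ (congrArg Sigma.fst h)) fun i =>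
    𝒢.Tsrc_Tmul (congrArg Sigma.fst h) (tangentPower_eq h i)
  tgt_mul _ _ h := tangentPower_ext (𝒢.tgt_mul _ _ (congrArg Sigma.fst h)) fun i =>
    𝒢.Ttgt_Tmul (congrArg Sigma.fst h) (tangentPower_eq h i)
  mul_assoc _ _ _ h h' :=
    tangentPower_ext (𝒢.mul_assoc _ _ _ (congrArg Sigma.fst h) (congrArg Sigma.fst h')) fun i =>
    𝒢.Tmul_assoc (congrArg Sigma.fst h) (congrArg Sigma.fst h') (tangentPower_eq h i)
      (tangentPower_eq h' i)
  mul_one _ := tangentPower_ext (𝒢.mul_one _) fun _ => 𝒢.Tmul_Tone _ _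
  one_mul _ := tangentPower_ext (𝒢.one_mul _) fun _ => 𝒢.Tone_Tmul _ _
  inv_mul _ := tangentPower_ext (𝒢.inv_mul _) fun _ => 𝒢.Tinv_Tmul _ _
  mul_inv _ := tangentPower_ext (𝒢.mul_inv _) fun _ => 𝒢.Tmul_Tinv _ _

end TangentGroupoid

section CotangentGroupoid

variable (𝒢 : LieGroupoid EG EM G M)

/-- The source of `α ∈ T*_g G` in `A*_{s(g)}`: `u ↦ α (Tl_g (u - Tt u))`, with `T_x M` included in
`T_{1_x} G` by the differential of the unit map. -/
noncomputable def srcCov (g : G) (α : EG →L[ℝ] ℝ) : 𝒢.algebroidFibre (𝒢.src g) →L[ℝ] ℝ :=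
  α ∘L 𝒢.Tleft g ∘L
    (ContinuousLinearMap.id ℝ EG - 𝒢.Tone (𝒢.src g) ∘L 𝒢.Ttgt (𝒢.one (𝒢.src g))) ∘L
    (𝒢.algebroidFibre (𝒢.src g)).subtypeL

/-- The target of `β ∈ T*_g G` in `A*_{t(g)}`: `v ↦ β (Tr_g v)`. -/
noncomputable def tgtCov (g : G) (β : EG →L[ℝ] ℝ) : 𝒢.algebroidFibre (𝒢.tgt g) →L[ℝ] ℝ :=
  β ∘L 𝒢.Tright g ∘L (𝒢.algebroidFibre (𝒢.tgt g)).subtypeL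

theorem sub_Tone_mem (x : M) (Z : EG) :
    Z - 𝒢.Tone x (𝒢.Tsrc (𝒢.one x) Z) ∈ 𝒢.algebroidFibre x := by
  rw [mem_algebroidFibre, map_sub, Tsrc_Tone, sub_self]

/-- The unit at `ξ ∈ A*_x`: the covector at `1_x` that extends `ξ` by zero on `T_x M`, along
`T_{1_x} G = A_x ⊕ T_x M`. -/
noncomputable def oneCov (x : M) (ξ : 𝒢.algebroidFibre x →L[ℝ] ℝ) : EG →L[ℝ] ℝ :=
  ξ ∘L (ContinuousLinearMap.id ℝ EG - 𝒢.Tone x ∘L 𝒢.Tsrc (𝒢.one x)).codRestrict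
    (𝒢.algebroidFibre x) (𝒢.sub_Tone_mem x)

/-- The inverse of `α ∈ T*_g G`: the covector `-α ∘ Ti` at `g⁻¹`. -/
noncomputable def invCov (g : G) (α : EG →L[ℝ] ℝ) : EG →L[ℝ] ℝ :=
  -(α ∘L 𝒢.Tinv (𝒢.inv g))

open Classical in
/-- The product `α ∘ β` of `α ∈ T*_g G`, `β ∈ T*_h G`: the covector at `gh` with
`(α ∘ β) (Tm (X, Y)) = α X + β Y` for all tangent vectors `(X, Y)` of `G⁽²⁾`. It exists whenever
`α` and `β` are composable (`exists_mulCov`), and is unique since `Tm` is onto (`Tmul_surjective`). -/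
noncomputable def mulCov (g h : G) (α β : EG →L[ℝ] ℝ) : EG →L[ℝ] ℝ :=
  if H : ∃ γ : EG →L[ℝ] ℝ, ∀ X Y : EG, 𝒢.Tsrc g X = 𝒢.Ttgt h Y →
      γ (𝒢.Tmul g h (X, Y)) = α X + β Y then H.choose else 0

theorem mul_inv_cancel_right {g h : G} (hgh : 𝒢.src g = 𝒢.tgt h) :
    𝒢.mul (𝒢.mul g h) (𝒢.inv h) = g := by
  rw [𝒢.mul_assoc _ _ _ hgh (𝒢.tgt_inv h).symm, 𝒢.mul_inv, ← hgh, 𝒢.mul_one]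

theorem Tmul_surjective {g h : G} (hgh : 𝒢.src g = 𝒢.tgt h) (Z : EG) :
    ∃ X Y : EG, 𝒢.Tsrc g X = 𝒢.Ttgt h Y ∧ 𝒢.Tmul g h (X, Y) = Z := by
  obtain ⟨Y, hY⟩ := 𝒢.Tsrc_surjective h (𝒢.Tsrc (𝒢.mul g h) Z)
  have hs : 𝒢.src (𝒢.mul g h) = 𝒢.src h := 𝒢.src_mul _ _ hgh
  have hp := 𝒢.mul_inv_cancel_right hgh
  have c0 : 𝒢.src (𝒢.mul g h) = 𝒢.tgt (𝒢.inv h) := by rw [hs, 𝒢.tgt_inv]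
  have c1 : 𝒢.Tsrc (𝒢.mul g h) Z = 𝒢.Ttgt (𝒢.inv h) (𝒢.Tinv h Y) := by rw [Ttgt_Tinv, hY]
  have c2 : 𝒢.Tsrc (𝒢.inv h) (𝒢.Tinv h Y) = 𝒢.Ttgt h Y := 𝒢.Tsrc_Tinv _ _
  refine ⟨𝒢.Tmul (𝒢.mul g h) (𝒢.inv h) (Z, 𝒢.Tinv h Y), Y, ?_, ?_⟩
  · have h1 := 𝒢.Tsrc_Tmul c0 c1
    rw [hp] at h1
    rw [h1, c2]
  · have h1 := 𝒢.Tmul_assoc c0 (𝒢.src_inv h) c1 c2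
    rw [hp, 𝒢.inv_mul, Tinv_Tmul, hY, ← hs, Tmul_Tone] at h1
    exact h1

theorem Tmul_left {g : G} {X Z : EG}
    (h : 𝒢.Tsrc g X = 𝒢.Ttgt (𝒢.one (𝒢.src g)) Z) :
    𝒢.Tmul g (𝒢.one (𝒢.src g)) (0, Z - 𝒢.Tone (𝒢.src g) (𝒢.Ttgt (𝒢.one (𝒢.src g)) Z)) =
      𝒢.Tmul g (𝒢.one (𝒢.src g)) (X, Z) - X := by
  have h1 := 𝒢.Tmul_Tone g X
  rw [h] at h1
  nth_rw 2 [← h1]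
  rw [← map_sub, Prod.mk_sub_mk, sub_self]

theorem Tmul_right {g : G} {Z Y : EG}
    (h : 𝒢.Tsrc (𝒢.one (𝒢.tgt g)) Z = 𝒢.Ttgt g Y) :
    𝒢.Tmul (𝒢.one (𝒢.tgt g)) g (Z - 𝒢.Tone (𝒢.tgt g) (𝒢.Tsrc (𝒢.one (𝒢.tgt g)) Z), 0) =
      𝒢.Tmul (𝒢.one (𝒢.tgt g)) g (Z, Y) - Y := by
  have h1 := 𝒢.Tone_Tmul g Y
  rw [← h] at h1
  nth_rw 2 [← h1]
  rw [← map_sub, Prod.mk_sub_mk, sub_self]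

theorem Ttgt_sub_Tone (x : M) (Z : EG) :
    𝒢.Ttgt (𝒢.one x) (Z - 𝒢.Tone x (𝒢.Ttgt (𝒢.one x) Z)) = 0 := by
  rw [map_sub, Ttgt_Tone, sub_self]

theorem srcCov_apply {g : G} {α : EG →L[ℝ] ℝ} {u : EG} (hu : u ∈ 𝒢.algebroidFibre (𝒢.src g))
    {X : EG} (hX : 𝒢.Tsrc g X = 𝒢.Ttgt (𝒢.one (𝒢.src g)) u) :
    𝒢.srcCov g α ⟨u, hu⟩ = α (𝒢.Tmul g (𝒢.one (𝒢.src g)) (X, u)) - α X := by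
  rw [← map_sub, ← Tmul_left 𝒢 hX, ← 𝒢.Tleft_apply g (𝒢.Ttgt_sub_Tone _ _)]
  rfl

theorem tgtCov_apply {g : G} {α : EG →L[ℝ] ℝ} {u : EG} (hu : u ∈ 𝒢.algebroidFibre (𝒢.tgt g)) :
    𝒢.tgtCov g α ⟨u, hu⟩ = α (𝒢.Tmul (𝒢.one (𝒢.tgt g)) g (u, 0)) := by
  rw [← 𝒢.Tright_apply g hu]
  rfl

theorem srcCov_apply_sub {g : G} {α : EG →L[ℝ] ℝ} {X Z : EG}
    (hX : 𝒢.Tsrc g X = 𝒢.Ttgt (𝒢.one (𝒢.src g)) Z) :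
    𝒢.srcCov g α ⟨_, 𝒢.sub_Tone_mem (𝒢.src g) Z⟩ =
      α (𝒢.Tmul g (𝒢.one (𝒢.src g)) (X, Z)) - α X := by
  have h1 : 𝒢.srcCov g α ⟨_, 𝒢.sub_Tone_mem (𝒢.src g) Z⟩ =
      α (𝒢.Tleft g (Z - 𝒢.Tone (𝒢.src g) (𝒢.Ttgt (𝒢.one (𝒢.src g)) Z))) := by
    have h2 : Z - 𝒢.Tone (𝒢.src g) (𝒢.Tsrc (𝒢.one (𝒢.src g)) Z) -
        𝒢.Tone (𝒢.src g) (𝒢.Ttgt (𝒢.one (𝒢.src g))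
          (Z - 𝒢.Tone (𝒢.src g) (𝒢.Tsrc (𝒢.one (𝒢.src g)) Z))) =
        Z - 𝒢.Tone (𝒢.src g) (𝒢.Ttgt (𝒢.one (𝒢.src g)) Z) := by
      rw [map_sub (𝒢.Ttgt _), Ttgt_Tone, map_sub]
      abel
    rw [← h2]
    rfl
  rw [h1, 𝒢.Tleft_apply g (𝒢.Ttgt_sub_Tone _ _), Tmul_left 𝒢 hX, map_sub]

theorem tgtCov_apply_sub {g : G} {α : EG →L[ℝ] ℝ} {Y Z : EG}
    (hY : 𝒢.Tsrc (𝒢.one (𝒢.tgt g)) Z = 𝒢.Ttgt g Y) :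
    𝒢.tgtCov g α ⟨_, 𝒢.sub_Tone_mem (𝒢.tgt g) Z⟩ =
      α (𝒢.Tmul (𝒢.one (𝒢.tgt g)) g (Z, Y)) - α Y := by
  rw [tgtCov_apply, Tmul_right 𝒢 hY, map_sub]

theorem add_eq_zero_of_Tmul_eq_zero {g h : G} (hgh : 𝒢.src g = 𝒢.tgt h) {α β : EG →L[ℝ] ℝ}
    (hαβ : ∀ (v : EG) (hv : v ∈ 𝒢.algebroidFibre (𝒢.src g))
      (hv' : v ∈ 𝒢.algebroidFibre (𝒢.tgt h)), 𝒢.srcCov g α ⟨v, hv⟩ = 𝒢.tgtCov h β ⟨v, hv'⟩)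
    {X Y : EG} (hXY : 𝒢.Tsrc g X = 𝒢.Ttgt h Y) (h0 : 𝒢.Tmul g h (X, Y) = 0) :
    α X + β Y = 0 := by
  have hY0 : 𝒢.Tsrc h Y = 0 := by rw [← 𝒢.Tsrc_Tmul hgh hXY, h0, map_zero]
  have hi : 𝒢.src h = 𝒢.tgt (𝒢.inv h) := (𝒢.tgt_inv h).symm
  have c1 : 𝒢.Tsrc h Y = 𝒢.Ttgt (𝒢.inv h) 0 := by rw [hY0, map_zero]
  have c2 : 𝒢.Tsrc (𝒢.inv h) (0 : EG) = 𝒢.Ttgt h 0 := by rw [map_zero, map_zero]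
  obtain ⟨v, hv⟩ : ∃ v, v = 𝒢.Tmul h (𝒢.inv h) (Y, 0) := ⟨_, rfl⟩
  have hvs : 𝒢.Tsrc (𝒢.one (𝒢.tgt h)) v = 0 := by
    rw [hv, ← 𝒢.mul_inv h, 𝒢.Tsrc_Tmul hi c1, map_zero]
  have hvt : 𝒢.Ttgt (𝒢.one (𝒢.tgt h)) v = 𝒢.Ttgt h Y := by
    rw [hv, ← 𝒢.mul_inv h, 𝒢.Ttgt_Tmul hi c1]
  have hY : 𝒢.Tmul (𝒢.one (𝒢.tgt h)) h (v, 0) = Y := by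
    have h1 := 𝒢.Tmul_assoc hi (𝒢.src_inv h) c1 c2
    rw [← hv, 𝒢.mul_inv, 𝒢.inv_mul, ← Prod.zero_eq_mk, map_zero] at h1
    have h2 := 𝒢.Tmul_Tone h Y
    rw [hY0, map_zero] at h2
    exact h1.trans h2
  have hX : 𝒢.Tmul g (𝒢.one (𝒢.src g)) (X, v) = 0 := by
    have h1 := 𝒢.Tmul_assoc hgh hi hXY c1
    rw [← hv, 𝒢.mul_inv, h0, ← hgh, ← Prod.zero_eq_mk, map_zero] at h1
    exact h1.symm
  have hmt : v ∈ 𝒢.algebroidFibre (𝒢.tgt h) := hvs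
  have hms : v ∈ 𝒢.algebroidFibre (𝒢.src g) := by rw [hgh]; exact hvs
  have e1 := hαβ v hms hmt
  rw [tgtCov_apply, hY, 𝒢.srcCov_apply hms (X := X) (by rw [hgh, hvt, hXY]), hX, map_zero] at e1
  linarith

theorem exists_mulCov {g h : G} (hgh : 𝒢.src g = 𝒢.tgt h) {α β : EG →L[ℝ] ℝ}
    (hαβ : ∀ (v : EG) (hv : v ∈ 𝒢.algebroidFibre (𝒢.src g))
      (hv' : v ∈ 𝒢.algebroidFibre (𝒢.tgt h)), 𝒢.srcCov g α ⟨v, hv⟩ = 𝒢.tgtCov h β ⟨v, hv'⟩) :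
    ∃ γ : EG →L[ℝ] ℝ, ∀ X Y : EG, 𝒢.Tsrc g X = 𝒢.Ttgt h Y →
      γ (𝒢.Tmul g h (X, Y)) = α X + β Y := by
  let W : Submodule ℝ (EG × EG) := LinearMap.ker
    ((𝒢.Tsrc g).toLinearMap ∘ₗ LinearMap.fst ℝ EG EG
      - (𝒢.Ttgt h).toLinearMap ∘ₗ LinearMap.snd ℝ EG EG)
  have hW : ∀ w : EG × EG, w ∈ W ↔ 𝒢.Tsrc g w.1 = 𝒢.Ttgt h w.2 := by
    intro w
    simp [W, sub_eq_zero]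
  let L : W →ₗ[ℝ] EG := (𝒢.Tmul g h).toLinearMap ∘ₗ W.subtype
  let φ : W →ₗ[ℝ] ℝ := (α.toLinearMap ∘ₗ LinearMap.fst ℝ EG EG
      + β.toLinearMap ∘ₗ LinearMap.snd ℝ EG EG) ∘ₗ W.subtype
  have hL : Function.Surjective L := by
    intro Z
    obtain ⟨X, Y, hXY, hZ⟩ := 𝒢.Tmul_surjective hgh Z
    exact ⟨⟨(X, Y), (hW _).2 hXY⟩, hZ⟩
  obtain ⟨R, hR⟩ := LinearMap.exists_rightInverse_of_surjective L (LinearMap.range_eq_top.2 hL)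
  refine ⟨LinearMap.toContinuousLinearMap (φ ∘ₗ R), fun X Y hXY => ?_⟩
  let w : W := ⟨(X, Y), (hW _).2 hXY⟩
  have h1 : L (w - R (L w)) = 0 := by
    rw [map_sub, sub_eq_zero]
    exact (LinearMap.congr_fun hR (L w)).symm
  have h2 : φ (w - R (L w)) = 0 :=
    𝒢.add_eq_zero_of_Tmul_eq_zero hgh hαβ ((hW _).1 (w - R (L w)).2) h1
  rw [map_sub, sub_eq_zero] at h2
  exact h2.symm

theorem mulCov_apply {g h : G} (hgh : 𝒢.src g = 𝒢.tgt h) {α β : EG →L[ℝ] ℝ}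
    (hαβ : ∀ (v : EG) (hv : v ∈ 𝒢.algebroidFibre (𝒢.src g))
      (hv' : v ∈ 𝒢.algebroidFibre (𝒢.tgt h)), 𝒢.srcCov g α ⟨v, hv⟩ = 𝒢.tgtCov h β ⟨v, hv'⟩)
    {X Y : EG} (hXY : 𝒢.Tsrc g X = 𝒢.Ttgt h Y) :
    𝒢.mulCov g h α β (𝒢.Tmul g h (X, Y)) = α X + β Y := by
  have H := 𝒢.exists_mulCov hgh hαβ
  unfold mulCov
  rw [dif_pos H]
  exact H.choose_spec X Y hXY

theorem cotangent_ext {E N : Type*} [NormedAddCommGroup E] [NormedSpace ℝ E]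
    [TopologicalSpace N] [ChartedSpace E N] {a b : Σ x : N, TangentSpace 𝓘(ℝ, E) x →L[ℝ] ℝ}
    (h1 : a.1 = b.1) (h2 : ∀ X : E, (a.2 : E →L[ℝ] ℝ) X = (b.2 : E →L[ℝ] ℝ) X) : a = b := by
  obtain ⟨x, a⟩ := a
  obtain ⟨y, b⟩ := b
  obtain rfl : x = y := h1
  congr 1
  exact ContinuousLinearMap.ext h2

theorem dualAlgebroid_ext {a b : Σ x : M, 𝒢.algebroidFibre x →L[ℝ] ℝ}
    (h1 : a.1 = b.1) (h2 : ∀ (v : EG) (hv : v ∈ 𝒢.algebroidFibre a.1)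
      (hv' : v ∈ 𝒢.algebroidFibre b.1), a.2 ⟨v, hv⟩ = b.2 ⟨v, hv'⟩) : a = b := by
  obtain ⟨x, a⟩ := a
  obtain ⟨y, b⟩ := b
  obtain rfl : x = y := h1
  congr 1
  ext v
  exact h2 v v.2 v.2

theorem dualAlgebroid_eq {a b : Σ x : M, 𝒢.algebroidFibre x →L[ℝ] ℝ}
    (h : a = b) (v : EG) (hv : v ∈ 𝒢.algebroidFibre a.1)
      (hv' : v ∈ 𝒢.algebroidFibre b.1) : a.2 ⟨v, hv⟩ = b.2 ⟨v, hv'⟩ := by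
  subst h; rfl

theorem oneCov_apply (x : M) (ξ : 𝒢.algebroidFibre x →L[ℝ] ℝ) (Z : EG) :
    𝒢.oneCov x ξ Z = ξ ⟨_, 𝒢.sub_Tone_mem x Z⟩ := rfl

theorem fibre_congr {x : M} (ξ : 𝒢.algebroidFibre x →L[ℝ] ℝ) {u v : EG} (h : u = v)
    (hu : u ∈ 𝒢.algebroidFibre x) (hv : v ∈ 𝒢.algebroidFibre x) : ξ ⟨u, hu⟩ = ξ ⟨v, hv⟩ := by
  subst h; rfl

theorem srcCov_oneCov (x : M) (ξ : 𝒢.algebroidFibre x →L[ℝ] ℝ) (v : EG)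
    (hv : v ∈ 𝒢.algebroidFibre (𝒢.src (𝒢.one x))) (hv' : v ∈ 𝒢.algebroidFibre x) :
    𝒢.srcCov (𝒢.one x) (𝒢.oneCov x ξ) ⟨v, hv⟩ = ξ ⟨v, hv'⟩ := by
  have hX : 𝒢.Tsrc (𝒢.one x) (𝒢.Tone x (𝒢.Ttgt (𝒢.one x) v)) =
      𝒢.Ttgt (𝒢.one (𝒢.src (𝒢.one x))) v := by
    rw [Tsrc_Tone, 𝒢.src_one]
  have h1 := 𝒢.Tone_Tmul (𝒢.one x) v
  rw [𝒢.tgt_one] at h1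
  rw [𝒢.srcCov_apply hv hX, 𝒢.src_one, h1, oneCov_apply, oneCov_apply, ← map_sub]
  apply fibre_congr
  rw [mem_algebroidFibre] at hv'
  show v - 𝒢.Tone x (𝒢.Tsrc (𝒢.one x) v) - (𝒢.Tone x (𝒢.Ttgt (𝒢.one x) v) - 𝒢.Tone x
    (𝒢.Tsrc (𝒢.one x) (𝒢.Tone x (𝒢.Ttgt (𝒢.one x) v)))) = v
  rw [hv', Tsrc_Tone, map_zero, sub_self, sub_zero, sub_zero]

theorem tgtCov_oneCov (x : M) (ξ : 𝒢.algebroidFibre x →L[ℝ] ℝ) (v : EG)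
    (hv : v ∈ 𝒢.algebroidFibre (𝒢.tgt (𝒢.one x))) (hv' : v ∈ 𝒢.algebroidFibre x) :
    𝒢.tgtCov (𝒢.one x) (𝒢.oneCov x ξ) ⟨v, hv⟩ = ξ ⟨v, hv'⟩ := by
  have h1 := 𝒢.Tmul_Tone (𝒢.one x) v
  rw [mem_algebroidFibre] at hv'
  rw [𝒢.src_one, hv', map_zero] at h1
  rw [tgtCov_apply, 𝒢.tgt_one, h1, oneCov_apply]
  apply fibre_congr
  rw [hv', map_zero, sub_zero]

theorem inv_inv (g : G) : 𝒢.inv (𝒢.inv g) = g := by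
  have h1 := 𝒢.mul_assoc _ _ _ (𝒢.src_inv (𝒢.inv g)) (𝒢.src_inv g)
  have h2 := 𝒢.mul_one (𝒢.inv (𝒢.inv g))
  have h3 := 𝒢.one_mul g
  rw [𝒢.src_inv, 𝒢.tgt_inv] at h2
  rw [𝒢.inv_mul, 𝒢.inv_mul, 𝒢.src_inv, h2, h3] at h1
  exact h1.symm

theorem Tmul_zero (g h : G) : 𝒢.Tmul g h (0, 0) = 0 := map_zero (𝒢.Tmul g h)

theorem Tright_inv (k : G) {X v : EG} (hv : 𝒢.Tsrc (𝒢.one (𝒢.src k)) v = 0)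
    (hX : 𝒢.Tsrc k X = 𝒢.Ttgt (𝒢.one (𝒢.src k)) v) :
    𝒢.Tmul (𝒢.one (𝒢.src k)) (𝒢.inv k) (v, 0) =
      𝒢.Tinv k X - 𝒢.Tinv k (𝒢.Tmul k (𝒢.one (𝒢.src k)) (X, v)) := by
  have hs1 : 𝒢.src k = 𝒢.tgt (𝒢.one (𝒢.src k)) := (𝒢.tgt_one _).symm
  have hk := 𝒢.mul_one k
  obtain ⟨P, hP⟩ : ∃ P, P = 𝒢.Tmul k (𝒢.one (𝒢.src k)) (X, v) := ⟨_, rfl⟩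
  have hPs : 𝒢.Tsrc k P = 0 := by
    have h1 := 𝒢.Tsrc_Tmul hs1 hX
    rwa [← hP, hk, hv] at h1
  have hPt : 𝒢.Ttgt k P = 𝒢.Ttgt k X := by
    have h1 := 𝒢.Ttgt_Tmul hs1 hX
    rwa [← hP, hk] at h1
  rw [← hP]
  have hRP : 𝒢.Tmul (𝒢.inv k) k (𝒢.Tinv k X, P) = v := by
    have h1 := 𝒢.Tmul_assoc (𝒢.src_inv k) hs1 (𝒢.Tsrc_Tinv k X) hX
    have h2 := 𝒢.Tone_Tmul (𝒢.one (𝒢.src k)) v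
    rw [𝒢.tgt_one] at h2
    rw [Tinv_Tmul, 𝒢.inv_mul, hX, h2, hk, ← hP] at h1
    exact h1.symm
  have hvQ : 𝒢.Tmul (𝒢.one (𝒢.src k)) (𝒢.inv k) (v, 𝒢.Tinv k P) = 𝒢.Tinv k X := by
    have h1 := 𝒢.Tmul_assoc (𝒢.src_inv k) (𝒢.tgt_inv k).symm
      ((𝒢.Tsrc_Tinv k X).trans hPt.symm) (𝒢.Ttgt_Tinv k P).symm
    have h2 := 𝒢.Tmul_Tone (𝒢.inv k) (𝒢.Tinv k X)
    rw [𝒢.src_inv, Tsrc_Tinv] at h2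
    rw [hRP, 𝒢.inv_mul, 𝒢.mul_inv, Tmul_Tinv, hPt, h2] at h1
    exact h1
  have h0Q : 𝒢.Tmul (𝒢.one (𝒢.src k)) (𝒢.inv k) (0, 𝒢.Tinv k P) = 𝒢.Tinv k P := by
    have h1 := 𝒢.Tone_Tmul (𝒢.inv k) (𝒢.Tinv k P)
    rwa [Ttgt_Tinv, hPs, map_zero, 𝒢.tgt_inv] at h1
  calc 𝒢.Tmul (𝒢.one (𝒢.src k)) (𝒢.inv k) (v, 0)
      = 𝒢.Tmul (𝒢.one (𝒢.src k)) (𝒢.inv k) ((v, 𝒢.Tinv k P) - (0, 𝒢.Tinv k P)) := by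
        rw [Prod.mk_sub_mk, sub_zero, sub_self]
    _ = 𝒢.Tinv k X - 𝒢.Tinv k P := by rw [map_sub, hvQ, h0Q]

theorem Tleft_inv (k : G) {v : EG} (hv : 𝒢.Tsrc (𝒢.one (𝒢.tgt k)) v = 0) :
    𝒢.Tmul (𝒢.inv k) (𝒢.one (𝒢.tgt k))
      (𝒢.Tinv k (𝒢.Tmul (𝒢.one (𝒢.tgt k)) k (v, 0)), v) = 0 := by
  have hs1 : 𝒢.src (𝒢.one (𝒢.tgt k)) = 𝒢.tgt k := 𝒢.src_one _
  have hk := 𝒢.one_mul k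
  have c1 : 𝒢.Tsrc (𝒢.one (𝒢.tgt k)) v = 𝒢.Ttgt k 0 := by rw [hv, map_zero]
  have c2 : 𝒢.Tsrc k (0 : EG) = 𝒢.Ttgt (𝒢.inv k) 0 := by rw [map_zero, map_zero]
  obtain ⟨P, hP⟩ : ∃ P, P = 𝒢.Tmul (𝒢.one (𝒢.tgt k)) k (v, 0) := ⟨_, rfl⟩
  have hPs : 𝒢.Tsrc k P = 0 := by
    have h1 := 𝒢.Tsrc_Tmul hs1 c1
    rwa [← hP, hk, map_zero] at h1
  rw [← hP]
  have hvP : 𝒢.Tmul k (𝒢.inv k) (P, 0) = v := by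
    have h1 := 𝒢.Tmul_assoc hs1 (𝒢.tgt_inv k).symm c1 c2
    have h2 := 𝒢.Tmul_Tone (𝒢.one (𝒢.tgt k)) v
    rw [𝒢.src_one, hv, map_zero] at h2
    rw [hk, ← hP, Tmul_zero, 𝒢.mul_inv, h2] at h1
    exact h1
  have h1 := 𝒢.Tmul_assoc (𝒢.src_inv k) (𝒢.tgt_inv k).symm (𝒢.Tsrc_Tinv k P)
    (Y := P) (Z := 0) (by rw [hPs, map_zero])
  rw [hvP, Tinv_Tmul, hPs, map_zero, Tmul_zero, 𝒢.mul_inv] at h1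
  exact h1.symm

theorem srcCov_invCov (g : G) (α : EG →L[ℝ] ℝ) (v : EG)
    (hv : v ∈ 𝒢.algebroidFibre (𝒢.src (𝒢.inv g))) (hv' : v ∈ 𝒢.algebroidFibre (𝒢.tgt g)) :
    𝒢.srcCov (𝒢.inv g) (𝒢.invCov g α) ⟨v, hv⟩ = 𝒢.tgtCov g α ⟨v, hv'⟩ := by
  obtain ⟨X, hX⟩ := 𝒢.Tsrc_surjective (𝒢.inv g) (𝒢.Ttgt (𝒢.one (𝒢.src (𝒢.inv g))) v)
  have h1 := 𝒢.Tright_inv (𝒢.inv g) hv hX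
  rw [inv_inv] at h1
  have h2 : 𝒢.Tmul (𝒢.one (𝒢.tgt g)) g (v, 0) =
      𝒢.Tmul (𝒢.one (𝒢.src (𝒢.inv g))) g (v, 0) := by rw [𝒢.src_inv]
  rw [tgtCov_apply, 𝒢.srcCov_apply hv hX, h2, h1, map_sub]
  simp only [invCov, neg_apply, ContinuousLinearMap.comp_apply]
  ring

theorem tgtCov_invCov (g : G) (α : EG →L[ℝ] ℝ) (v : EG)
    (hv : v ∈ 𝒢.algebroidFibre (𝒢.tgt (𝒢.inv g))) (hv' : v ∈ 𝒢.algebroidFibre (𝒢.src g)) :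
    𝒢.tgtCov (𝒢.inv g) (𝒢.invCov g α) ⟨v, hv⟩ = 𝒢.srcCov g α ⟨v, hv'⟩ := by
  have h1 := 𝒢.Tleft_inv (𝒢.inv g) hv
  have hX : 𝒢.Tsrc g (𝒢.Tinv (𝒢.inv g) (𝒢.Tmul (𝒢.one (𝒢.tgt (𝒢.inv g))) (𝒢.inv g) (v, 0))) =
      𝒢.Ttgt (𝒢.one (𝒢.src g)) v := by
    have h2 := 𝒢.Tsrc_Tinv (𝒢.inv g) (𝒢.Tmul (𝒢.one (𝒢.tgt (𝒢.inv g))) (𝒢.inv g) (v, 0))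
    have h3 := 𝒢.Ttgt_Tmul (g := 𝒢.one (𝒢.tgt (𝒢.inv g))) (h := 𝒢.inv g) (X := v) (Y := 0)
      (𝒢.src_one _) (by rw [map_zero]; exact hv)
    rw [𝒢.one_mul] at h3
    rw [inv_inv, h3] at h2
    rw [h2, 𝒢.tgt_inv]
  have h4 : 𝒢.Tmul g (𝒢.one (𝒢.src g))
      (𝒢.Tinv (𝒢.inv g) (𝒢.Tmul (𝒢.one (𝒢.tgt (𝒢.inv g))) (𝒢.inv g) (v, 0)), v) = 0 := by
    rw [inv_inv, 𝒢.tgt_inv] at h1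
    rw [𝒢.tgt_inv]
    exact h1
  rw [tgtCov_apply, 𝒢.srcCov_apply hv' hX, h4, map_zero, zero_sub]
  rfl

theorem srcCov_mulCov {g h : G} (hgh : 𝒢.src g = 𝒢.tgt h) {α β : EG →L[ℝ] ℝ}
    (hαβ : ∀ (v : EG) (hv : v ∈ 𝒢.algebroidFibre (𝒢.src g))
      (hv' : v ∈ 𝒢.algebroidFibre (𝒢.tgt h)), 𝒢.srcCov g α ⟨v, hv⟩ = 𝒢.tgtCov h β ⟨v, hv'⟩)
    (v : EG) (hv : v ∈ 𝒢.algebroidFibre (𝒢.src (𝒢.mul g h)))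
    (hv' : v ∈ 𝒢.algebroidFibre (𝒢.src h)) :
    𝒢.srcCov (𝒢.mul g h) (𝒢.mulCov g h α β) ⟨v, hv⟩ = 𝒢.srcCov h β ⟨v, hv'⟩ := by
  obtain ⟨X, hX⟩ := 𝒢.Tsrc_surjective (𝒢.mul g h) (𝒢.Ttgt (𝒢.one (𝒢.src (𝒢.mul g h))) v)
  obtain ⟨A, B, hAB, rfl⟩ := 𝒢.Tmul_surjective hgh X
  have hB : 𝒢.Tsrc h B = 𝒢.Ttgt (𝒢.one (𝒢.src h)) v := by
    rw [← 𝒢.Tsrc_Tmul hgh hAB, hX, 𝒢.src_mul _ _ hgh]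
  have hs : 𝒢.src h = 𝒢.tgt (𝒢.one (𝒢.src h)) := (𝒢.tgt_one _).symm
  have hc : 𝒢.Tsrc g A = 𝒢.Ttgt h (𝒢.Tmul h (𝒢.one (𝒢.src h)) (B, v)) := by
    have h1 := 𝒢.Ttgt_Tmul hs hB
    rw [𝒢.mul_one] at h1
    rw [h1, hAB]
  rw [𝒢.srcCov_apply hv hX, 𝒢.srcCov_apply hv' hB, 𝒢.mulCov_apply hgh hαβ hAB,
    𝒢.src_mul _ _ hgh, 𝒢.Tmul_assoc hgh hs hAB hB, 𝒢.mul_one, 𝒢.mulCov_apply hgh hαβ hc]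
  ring

theorem tgtCov_mulCov {g h : G} (hgh : 𝒢.src g = 𝒢.tgt h) {α β : EG →L[ℝ] ℝ}
    (hαβ : ∀ (v : EG) (hv : v ∈ 𝒢.algebroidFibre (𝒢.src g))
      (hv' : v ∈ 𝒢.algebroidFibre (𝒢.tgt h)), 𝒢.srcCov g α ⟨v, hv⟩ = 𝒢.tgtCov h β ⟨v, hv'⟩)
    (v : EG) (hv : v ∈ 𝒢.algebroidFibre (𝒢.tgt (𝒢.mul g h)))
    (hv' : v ∈ 𝒢.algebroidFibre (𝒢.tgt g)) :
    𝒢.tgtCov (𝒢.mul g h) (𝒢.mulCov g h α β) ⟨v, hv⟩ = 𝒢.tgtCov g α ⟨v, hv'⟩ := by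
  have c0 : 𝒢.Tsrc (𝒢.one (𝒢.tgt g)) v = 𝒢.Ttgt g 0 := by rw [map_zero]; exact hv'
  have c1 : 𝒢.Tsrc g (0 : EG) = 𝒢.Ttgt h 0 := by rw [map_zero, map_zero]
  have h1 := 𝒢.Tmul_assoc (𝒢.src_one (𝒢.tgt g)) hgh c0 c1
  have c2 : 𝒢.Tsrc g (𝒢.Tmul (𝒢.one (𝒢.tgt g)) g (v, 0)) = 𝒢.Ttgt h 0 := by
    have h2 := 𝒢.Tsrc_Tmul (𝒢.src_one (𝒢.tgt g)) c0
    rw [𝒢.one_mul] at h2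
    rw [h2, c1]
  rw [Tmul_zero, 𝒢.one_mul] at h1
  rw [tgtCov_apply, tgtCov_apply, 𝒢.tgt_mul _ _ hgh, ← h1, 𝒢.mulCov_apply hgh hαβ c2,
    map_zero, add_zero]

theorem mulCov_assoc {g h k : G} (hgh : 𝒢.src g = 𝒢.tgt h) (hhk : 𝒢.src h = 𝒢.tgt k)
    {α β δ : EG →L[ℝ] ℝ}
    (hαβ : ∀ (v : EG) (hv : v ∈ 𝒢.algebroidFibre (𝒢.src g))
      (hv' : v ∈ 𝒢.algebroidFibre (𝒢.tgt h)), 𝒢.srcCov g α ⟨v, hv⟩ = 𝒢.tgtCov h β ⟨v, hv'⟩)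
    (hβδ : ∀ (v : EG) (hv : v ∈ 𝒢.algebroidFibre (𝒢.src h))
      (hv' : v ∈ 𝒢.algebroidFibre (𝒢.tgt k)), 𝒢.srcCov h β ⟨v, hv⟩ = 𝒢.tgtCov k δ ⟨v, hv'⟩)
    (W : EG) : 𝒢.mulCov (𝒢.mul g h) k (𝒢.mulCov g h α β) δ W =
      𝒢.mulCov g (𝒢.mul h k) α (𝒢.mulCov h k β δ) W := by
  have e1 : 𝒢.src (𝒢.mul g h) = 𝒢.src h := 𝒢.src_mul _ _ hgh
  have e2 : 𝒢.tgt (𝒢.mul h k) = 𝒢.tgt h := 𝒢.tgt_mul _ _ hhk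
  have d1 : 𝒢.src (𝒢.mul g h) = 𝒢.tgt k := e1.trans hhk
  have d2 : 𝒢.src g = 𝒢.tgt (𝒢.mul h k) := hgh.trans e2.symm
  obtain ⟨P, Z, hPZ, rfl⟩ := 𝒢.Tmul_surjective d1 W
  obtain ⟨X, Y, hXY, rfl⟩ := 𝒢.Tmul_surjective hgh P
  have hYZ : 𝒢.Tsrc h Y = 𝒢.Ttgt k Z := by rw [← hPZ, 𝒢.Tsrc_Tmul hgh hXY]
  have hXP : 𝒢.Tsrc g X = 𝒢.Ttgt (𝒢.mul h k) (𝒢.Tmul h k (Y, Z)) := by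
    rw [𝒢.Ttgt_Tmul hhk hYZ, hXY]
  rw [𝒢.mulCov_apply d1 _ hPZ, 𝒢.mulCov_apply hgh hαβ hXY, 𝒢.Tmul_assoc hgh hhk hXY hYZ,
    𝒢.mulCov_apply d2 _ hXP, 𝒢.mulCov_apply hhk hβδ hYZ, add_assoc]
  · intro v hv hv'
    rw [𝒢.tgtCov_mulCov hhk hβδ v hv' (by rwa [← e2])]
    exact hαβ v hv _
  · intro v hv hv'
    rw [𝒢.srcCov_mulCov hgh hαβ v hv (by rwa [← e1])]
    exact hβδ v _ hv'

theorem mulCov_oneCov (g : G) (α : EG →L[ℝ] ℝ) (W : EG) :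
    𝒢.mulCov g (𝒢.one (𝒢.src g)) α (𝒢.oneCov (𝒢.src g) (𝒢.srcCov g α)) W = α W := by
  have d : 𝒢.src g = 𝒢.tgt (𝒢.one (𝒢.src g)) := (𝒢.tgt_one _).symm
  obtain ⟨X, Y, hXY, hW⟩ := 𝒢.Tmul_surjective d (W : EG)
  rw [← hW, 𝒢.mulCov_apply d (fun v hv hv' => (𝒢.tgtCov_oneCov _ _ v hv' hv).symm) hXY,
    oneCov_apply, 𝒢.srcCov_apply_sub hXY]
  ring

theorem oneCov_mulCov (g : G) (α : EG →L[ℝ] ℝ) (W : EG) :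
    𝒢.mulCov (𝒢.one (𝒢.tgt g)) g (𝒢.oneCov (𝒢.tgt g) (𝒢.tgtCov g α)) α W = α W := by
  have d : 𝒢.src (𝒢.one (𝒢.tgt g)) = 𝒢.tgt g := 𝒢.src_one _
  obtain ⟨X, Y, hXY, hW⟩ := 𝒢.Tmul_surjective d (W : EG)
  rw [← hW, 𝒢.mulCov_apply d (fun v hv hv' => 𝒢.srcCov_oneCov _ _ v hv hv') hXY,
    oneCov_apply, 𝒢.tgtCov_apply_sub hXY]
  ring

theorem invCov_mulCov (g : G) (α : EG →L[ℝ] ℝ) (W : EG) :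
    𝒢.mulCov (𝒢.inv g) g (𝒢.invCov g α) α W = 𝒢.oneCov (𝒢.src g) (𝒢.srcCov g α) W := by
  obtain ⟨X, Y, hXY, hW⟩ := 𝒢.Tmul_surjective (𝒢.src_inv g) (W : EG)
  have ht := 𝒢.Ttgt_Tmul (𝒢.src_inv g) hXY
  have h1 := 𝒢.Tsrc_Tinv (𝒢.inv g) X
  have h2 := 𝒢.Tinv_Tmul (𝒢.inv g) X
  rw [inv_inv] at h1 h2
  rw [𝒢.src_inv] at h2
  rw [𝒢.inv_mul] at ht
  have h3 := 𝒢.Tmul_assoc (𝒢.tgt_inv g).symm (𝒢.src_inv g) h1 hXY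
  rw [h2, 𝒢.mul_inv, 𝒢.inv_mul, hXY, Tone_Tmul] at h3
  rw [← hW, 𝒢.mulCov_apply (𝒢.src_inv g) (fun v hv hv' => 𝒢.srcCov_invCov g α v hv hv') hXY,
    oneCov_apply, 𝒢.srcCov_apply_sub (h1.trans ht.symm), ← h3]
  simp only [invCov, neg_apply, ContinuousLinearMap.comp_apply]
  ring

theorem mulCov_invCov (g : G) (α : EG →L[ℝ] ℝ) (W : EG) :
    𝒢.mulCov g (𝒢.inv g) α (𝒢.invCov g α) W = 𝒢.oneCov (𝒢.tgt g) (𝒢.tgtCov g α) W := by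
  have d : 𝒢.src g = 𝒢.tgt (𝒢.inv g) := (𝒢.tgt_inv g).symm
  obtain ⟨X, Y, hXY, hW⟩ := 𝒢.Tmul_surjective d (W : EG)
  have hs := 𝒢.Tsrc_Tmul d hXY
  have h1 := 𝒢.Ttgt_Tinv (𝒢.inv g) Y
  have h2 := 𝒢.Tmul_Tinv (𝒢.inv g) Y
  rw [inv_inv] at h1 h2
  rw [𝒢.tgt_inv, ← hXY] at h2
  rw [𝒢.mul_inv] at hs
  have h3 := 𝒢.Tmul_assoc d (𝒢.src_inv g) hXY h1.symm
  rw [h2, 𝒢.mul_inv, 𝒢.inv_mul, Tmul_Tone] at h3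
  rw [← hW, 𝒢.mulCov_apply d (fun v hv hv' => (𝒢.tgtCov_invCov g α v hv' hv).symm) hXY,
    oneCov_apply, 𝒢.tgtCov_apply_sub (hs.trans h1.symm), h3]
  simp only [invCov, neg_apply, ContinuousLinearMap.comp_apply]
  ring

/-- The source map `T*G → A*`. -/
noncomputable def cotangentSrc (a : Σ g : G, TangentSpace 𝓘(ℝ, EG) g →L[ℝ] ℝ) :
    Σ x : M, 𝒢.algebroidFibre x →L[ℝ] ℝ := ⟨𝒢.src a.1, 𝒢.srcCov a.1 a.2⟩

/-- The target map `T*G → A*`. -/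
noncomputable def cotangentTgt (a : Σ g : G, TangentSpace 𝓘(ℝ, EG) g →L[ℝ] ℝ) :
    Σ x : M, 𝒢.algebroidFibre x →L[ℝ] ℝ := ⟨𝒢.tgt a.1, 𝒢.tgtCov a.1 a.2⟩

theorem cotangent_composable {a b : Σ g : G, TangentSpace 𝓘(ℝ, EG) g →L[ℝ] ℝ}
    (h : 𝒢.cotangentSrc a = 𝒢.cotangentTgt b) : 𝒢.src a.1 = 𝒢.tgt b.1 ∧
    ∀ (v : EG) (hv : v ∈ 𝒢.algebroidFibre (𝒢.src a.1)) (hv' : v ∈ 𝒢.algebroidFibre (𝒢.tgt b.1)),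
      𝒢.srcCov a.1 a.2 ⟨v, hv⟩ = 𝒢.tgtCov b.1 b.2 ⟨v, hv'⟩ :=
  ⟨congrArg Sigma.fst h, fun v hv hv' => 𝒢.dualAlgebroid_eq h v hv hv'⟩

/-- The cotangent groupoid `T*G` over `A*`. -/
noncomputable def cotangentGroupoid :
    SetGroupoid (Σ g : G, TangentSpace 𝓘(ℝ, EG) g →L[ℝ] ℝ)
      (Σ x : M, 𝒢.algebroidFibre x →L[ℝ] ℝ) where
  src := 𝒢.cotangentSrc
  tgt := 𝒢.cotangentTgt
  one ξ := ⟨𝒢.one ξ.1, 𝒢.oneCov ξ.1 ξ.2⟩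
  inv a := ⟨𝒢.inv a.1, 𝒢.invCov a.1 a.2⟩
  mul a b := ⟨𝒢.mul a.1 b.1, 𝒢.mulCov a.1 b.1 a.2 b.2⟩
  src_one ξ := 𝒢.dualAlgebroid_ext (𝒢.src_one _) (𝒢.srcCov_oneCov ξ.1 ξ.2)
  tgt_one ξ := 𝒢.dualAlgebroid_ext (𝒢.tgt_one _) (𝒢.tgtCov_oneCov ξ.1 ξ.2)
  src_inv a := 𝒢.dualAlgebroid_ext (𝒢.src_inv _) (𝒢.srcCov_invCov a.1 a.2)
  tgt_inv a := 𝒢.dualAlgebroid_ext (𝒢.tgt_inv _) (𝒢.tgtCov_invCov a.1 a.2)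
  src_mul a b h := by
    obtain ⟨h1, h2⟩ := 𝒢.cotangent_composable h
    exact 𝒢.dualAlgebroid_ext (𝒢.src_mul _ _ h1) (𝒢.srcCov_mulCov h1 h2)
  tgt_mul a b h := by
    obtain ⟨h1, h2⟩ := 𝒢.cotangent_composable h
    exact 𝒢.dualAlgebroid_ext (𝒢.tgt_mul _ _ h1) (𝒢.tgtCov_mulCov h1 h2)
  mul_assoc a b c h h' := by
    obtain ⟨h1, h2⟩ := 𝒢.cotangent_composable h
    obtain ⟨h1', h2'⟩ := 𝒢.cotangent_composable h'
    exact cotangent_ext (𝒢.mul_assoc _ _ _ h1 h1') (𝒢.mulCov_assoc h1 h1' h2 h2')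
  mul_one a := cotangent_ext (𝒢.mul_one _) (𝒢.mulCov_oneCov a.1 a.2)
  one_mul a := cotangent_ext (𝒢.one_mul _) (𝒢.oneCov_mulCov a.1 a.2)
  inv_mul a := cotangent_ext (𝒢.inv_mul _) (𝒢.invCov_mulCov a.1 a.2)
  mul_inv a := cotangent_ext (𝒢.mul_inv _) (𝒢.mulCov_invCov a.1 a.2)

end CotangentGroupoid

end LieGroupoid

/-- A smooth differential `k`-form on the manifold `G`: an alternating `k`-linear form on each
tangent space whose coordinate expression in the trivialization of the tangent bundle around any
point is smooth. -/
structure DifferentialForm (EG G : Type*) [NormedAddCommGroup EG] [NormedSpace ℝ EG]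
    [TopologicalSpace G] [ChartedSpace EG G] [IsManifold 𝓘(ℝ, EG) ∞ G] (k : ℕ) where
  toFun : ∀ g : G, TangentSpace 𝓘(ℝ, EG) g [⋀^Fin k]→L[ℝ] ℝ
  smooth : ∀ g₀ : G, ContMDiffAt 𝓘(ℝ, EG) 𝓘(ℝ, EG [⋀^Fin k]→L[ℝ] ℝ) ∞
    (fun g => (toFun g).compContinuousLinearMap
      ((trivializationAt EG (TangentSpace 𝓘(ℝ, EG) : G → Type _) g₀).symmL ℝ g)) g₀

namespace DifferentialForm

variable {EG G : Type*} [NormedAddCommGroup EG] [NormedSpace ℝ EG]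
    [TopologicalSpace G] [ChartedSpace EG G] [IsManifold 𝓘(ℝ, EG) ∞ G]

/-- The bundle map `α♯ : ⊕ⁿ TG → T*G` of an `(n+1)`-form `α`, covering the identity of `G`:
`α♯(X₁, …, Xₙ) = α(X₁, …, Xₙ, ·)`. -/
noncomputable def sharp {n : ℕ} (α : DifferentialForm EG G (n + 1))
    (X : Σ g : G, Fin n → TangentSpace 𝓘(ℝ, EG) g) :
    Σ g : G, TangentSpace 𝓘(ℝ, EG) g →L[ℝ] ℝ :=
  ⟨X.1, (α.toFun X.1).toContinuousMultilinearMap.toContinuousLinearMap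
    (Fin.snoc (α := fun _ => TangentSpace 𝓘(ℝ, EG) X.1) X.2 0) (Fin.last n)⟩

theorem sharp_apply {n : ℕ} (α : DifferentialForm EG G (n + 1)) {g : G}
    (X : Fin n → TangentSpace 𝓘(ℝ, EG) g) (v : TangentSpace 𝓘(ℝ, EG) g) :
    (α.sharp ⟨g, X⟩).2 v =
      α.toFun g (Fin.snoc (α := fun _ => TangentSpace 𝓘(ℝ, EG) g) X v) := by
  show α.toFun g (Function.update (Fin.snoc (α := fun _ => TangentSpace 𝓘(ℝ, EG) g) X 0)
    (Fin.last n) v) = _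
  rw [Fin.update_snoc_last]

end DifferentialForm

namespace LieGroupoid

variable {EG EM G M : Type*} [NormedAddCommGroup EG] [NormedSpace ℝ EG]
    [NormedAddCommGroup EM] [NormedSpace ℝ EM] [TopologicalSpace G] [ChartedSpace EG G]
    [TopologicalSpace M] [ChartedSpace EM M]
    [FiniteDimensional ℝ EG] [FiniteDimensional ℝ EM]
    [IsManifold 𝓘(ℝ, EG) ∞ G] [IsManifold 𝓘(ℝ, EM) ∞ M]

/-- The tangent space `{(X, Y) | Ts X = Tt Y}` at `p` of the submanifold `G⁽²⁾` of `G × G`. -/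
noncomputable def tangentComposable (𝒢 : LieGroupoid EG EM G M) (p : G × G) :
    Submodule ℝ (EG × EG) :=
  LinearMap.ker (((𝒢.Tsrc p.1).comp (ContinuousLinearMap.fst ℝ EG EG) -
    (𝒢.Ttgt p.2).comp (ContinuousLinearMap.snd ℝ EG EG)).toLinearMap)

/-- The pullback `f*α` to `G⁽²⁾` of a form `α` on `G`, at the point `p`, for a map `f` from `G⁽²⁾`
to `G` (recorded as a map on `G × G`). -/
noncomputable def pullbackComposable (𝒢 : LieGroupoid EG EM G M) {k : ℕ} (f : G × G → G)
    (α : DifferentialForm EG G k) (p : G × G) : 𝒢.tangentComposable p [⋀^Fin k]→L[ℝ] ℝ :=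
  (α.toFun (f p)).compContinuousLinearMap
    ((mfderivWithin (𝓘(ℝ, EG).prod 𝓘(ℝ, EG)) 𝓘(ℝ, EG) f 𝒢.composable p : EG × EG →L[ℝ] EG).comp
      (𝒢.tangentComposable p).subtypeL)

/-- `α` is multiplicative: `m*α = p₁*α + p₂*α` on `G⁽²⁾`. -/
def IsMultiplicative (𝒢 : LieGroupoid EG EM G M) {k : ℕ} (α : DifferentialForm EG G k) : Prop :=
  ∀ p ∈ 𝒢.composable,
    𝒢.pullbackComposable (fun q => 𝒢.mul q.1 q.2) α p =
      𝒢.pullbackComposable Prod.fst α p + 𝒢.pullbackComposable Prod.snd α p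

end LieGroupoid

/-!
Both sides of the equivalence are pointwise statements about the tangent groupoid. Since the
tangent vectors of `G⁽²⁾` are the pairs `(X, Y)` with `Ts X = Tt Y`, a form `α` of degree `n + 1` is
multiplicative exactly when, for composable families of vectors,
`α (Tm (X₁, Y₁), …, Tm (Xₙ₊₁, Yₙ₊₁)) = α (X₁, …, Xₙ₊₁) + α (Y₁, …, Yₙ₊₁)`
(`isMultiplicative_iff_sharpAt`, where the last slot is singled out so that the identity reads
`α♯ (X · Y) (Tm (U, V)) = α♯ X U + α♯ Y V`).

This identity is the defining property of the product in `T*G`, so a morphism is multiplicative.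
Conversely, if `α` is multiplicative, write `X ∈ T_g G` as `X · T1 (Ts X)` and as `T1 (Tt X) · X`.
The identity then shows that the source and the target of `α♯ (X₁, …, Xₙ)` are the values of
`Z ↦ α (T1 Z₁, …, T1 Zₙ, ·)`, restricted to the Lie algebroid, at `Z = Ts X` and `Z = Tt X`
(`srcCov_sharpAt`, `tgtCov_sharpAt`); this is the map of the objects. Applied to units, the identity
gives `α (T1 Z₁, …, T1 Zₙ₊₁) = 2 α (T1 Z₁, …, T1 Zₙ₊₁)`, so `α` vanishes on vectors tangent to
the units and `α♯` preserves units. That `α♯` preserves products follows as `Tm` is onto.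
-/

namespace DifferentialForm

variable {EG G : Type*} [NormedAddCommGroup EG] [NormedSpace ℝ EG] [TopologicalSpace G]
    [ChartedSpace EG G] [IsManifold 𝓘(ℝ, EG) ∞ G] {n : ℕ} (α : DifferentialForm EG G (n + 1))

/-- The covector `α♯ (X₁, …, Xₙ)` at `g`, with all tangent spaces identified with the model
space. -/
noncomputable def sharpAt (g : G) (X : Fin n → EG) : EG →L[ℝ] ℝ := (α.sharp ⟨g, X⟩).2

theorem sharpAt_apply (g : G) (X : Fin n → EG) (v : EG) :
    α.sharpAt g X v = α.toFun g (Fin.snoc (α := fun _ => EG) X v) :=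
  α.sharp_apply _ _

end DifferentialForm

namespace LieGroupoid

variable {EG EM G M : Type*} [NormedAddCommGroup EG] [NormedSpace ℝ EG]
    [NormedAddCommGroup EM] [NormedSpace ℝ EM] [TopologicalSpace G] [ChartedSpace EG G]
    [TopologicalSpace M] [ChartedSpace EM M]
    [FiniteDimensional ℝ EG] [FiniteDimensional ℝ EM]
    [IsManifold 𝓘(ℝ, EG) ∞ G] [IsManifold 𝓘(ℝ, EM) ∞ M]
    (𝒢 : LieGroupoid EG EM G M)

theorem mem_tangentComposable {p : G × G} {w : EG × EG} :
    w ∈ 𝒢.tangentComposable p ↔ 𝒢.Tsrc p.1 w.1 = 𝒢.Ttgt p.2 w.2 :=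
  sub_eq_zero

/-- The derivative within `G⁽²⁾` of a map `f` is determined on the tangent vectors of `G⁽²⁾`, even
though it is not unique on the ambient space: these vectors are velocities of curves in `G⁽²⁾`. -/
theorem mfderivWithin_composable_eq {f : G × G → G} {g h : G} {L : EG × EG →L[ℝ] EG}
    (hL : HasMFDerivAt (𝓘(ℝ, EG).prod 𝓘(ℝ, EG)) 𝓘(ℝ, EG) f (g, h) L)
    (hgh : 𝒢.src g = 𝒢.tgt h) {X Y : EG} (hXY : 𝒢.Tsrc g X = 𝒢.Ttgt h Y) :
    (mfderivWithin (𝓘(ℝ, EG).prod 𝓘(ℝ, EG)) 𝓘(ℝ, EG) f 𝒢.composable (g, h) : EG × EG →L[ℝ] EG)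
      (X, Y) = L (X, Y) := by
  obtain ⟨a, b, rfl, rfl, ha, hb, hl⟩ := 𝒢.exists_curves hgh hXY
  have hW := hL.hasMFDerivWithinAt (s := 𝒢.composable)
  have hD := hW.mdifferentiableWithinAt.hasMFDerivWithinAt
  have h1 : HasMFDerivWithinAt 𝓘(ℝ, ℝ) (𝓘(ℝ, EG).prod 𝓘(ℝ, EG)) (fun t => (a t, b t))
      {t | 𝒢.src (a t) = 𝒢.tgt (b t)} 0
      (ContinuousLinearMap.toSpanSingleton ℝ (X, Y) : ℝ →L[ℝ] EG × EG) :=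
    HasMFDerivAt.hasMFDerivWithinAt (ha.prodMk hb)
  have h2 := (HasMFDerivWithinAt.comp (0 : ℝ) (u := 𝒢.composable) hW h1
    (fun t ht => ht)).hasMFDerivAt hl
  have h3 := (HasMFDerivWithinAt.comp (0 : ℝ) (u := 𝒢.composable) hD h1
    (fun t ht => ht)).hasMFDerivAt hl
  have h4 : (mfderivWithin (𝓘(ℝ, EG).prod 𝓘(ℝ, EG)) 𝓘(ℝ, EG) f 𝒢.composable (a 0, b 0) :
      EG × EG →L[ℝ] EG) ((1 : ℝ) • (X, Y)) = L ((1 : ℝ) • (X, Y)) :=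
    congrArg (fun T : ℝ →L[ℝ] EG => T 1) (hasMFDerivAt_unique h3 h2)
  rwa [one_smul] at h4

theorem mfderivWithin_fst_composable {g h : G} (hgh : 𝒢.src g = 𝒢.tgt h) {X Y : EG}
    (hXY : 𝒢.Tsrc g X = 𝒢.Ttgt h Y) :
    (mfderivWithin (𝓘(ℝ, EG).prod 𝓘(ℝ, EG)) 𝓘(ℝ, EG) (Prod.fst : G × G → G) 𝒢.composable (g, h) :
      EG × EG →L[ℝ] EG) (X, Y) = X :=
  𝒢.mfderivWithin_composable_eq (hasMFDerivAt_fst (g, h)) hgh hXY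

theorem mfderivWithin_snd_composable {g h : G} (hgh : 𝒢.src g = 𝒢.tgt h) {X Y : EG}
    (hXY : 𝒢.Tsrc g X = 𝒢.Ttgt h Y) :
    (mfderivWithin (𝓘(ℝ, EG).prod 𝓘(ℝ, EG)) 𝓘(ℝ, EG) (Prod.snd : G × G → G) 𝒢.composable (g, h) :
      EG × EG →L[ℝ] EG) (X, Y) = Y :=
  𝒢.mfderivWithin_composable_eq (hasMFDerivAt_snd (g, h)) hgh hXY

/-- Multiplicativity in terms of tangent vectors of `G`: the differentials within `G⁽²⁾` in the
pullbacks along the two projections become the projections of `(X, Y)`. -/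
theorem isMultiplicative_iff {k : ℕ} (α : DifferentialForm EG G k) :
    𝒢.IsMultiplicative α ↔ ∀ g h : G, 𝒢.src g = 𝒢.tgt h → ∀ X Y : Fin k → EG,
      (∀ i, 𝒢.Tsrc g (X i) = 𝒢.Ttgt h (Y i)) →
      α.toFun (𝒢.mul g h) (fun i => 𝒢.Tmul g h (X i, Y i)) = α.toFun g X + α.toFun h Y := by
  have key : ∀ g h : G, 𝒢.src g = 𝒢.tgt h → ∀ w : Fin k → 𝒢.tangentComposable (g, h),
      𝒢.pullbackComposable Prod.fst α (g, h) w = α.toFun g (fun i => (w i).1.1) ∧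
      𝒢.pullbackComposable Prod.snd α (g, h) w = α.toFun h (fun i => (w i).1.2) := by
    intro g h hgh w
    constructor
    · exact congrArg (α.toFun g) (funext fun i =>
        𝒢.mfderivWithin_fst_composable hgh (𝒢.mem_tangentComposable.1 (w i).2))
    · exact congrArg (α.toFun h) (funext fun i =>
        𝒢.mfderivWithin_snd_composable hgh (𝒢.mem_tangentComposable.1 (w i).2))
  constructor
  · intro H g h hgh X Y hXY
    let w : Fin k → 𝒢.tangentComposable (g, h) :=
      fun i => ⟨(X i, Y i), 𝒢.mem_tangentComposable.2 (hXY i)⟩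
    have h1 := congrArg (fun T => T w) (H (g, h) hgh)
    obtain ⟨h2, h3⟩ := key g h hgh w
    refine Eq.trans h1 ?_
    exact congrArg₂ (· + ·) h2 h3
  · rintro H ⟨g, h⟩ hgh
    ext w
    obtain ⟨h2, h3⟩ := key g h hgh w
    refine (H g h hgh _ _ fun i => 𝒢.mem_tangentComposable.1 (w i).2).trans ?_
    exact (congrArg₂ (· + ·) h2 h3).symm

variable {n : ℕ} {α : DifferentialForm EG G (n + 1)}

/-- Multiplicativity in terms of `α♯`: the identity that defines the product in `T*G`. -/
theorem isMultiplicative_iff_sharpAt (α : DifferentialForm EG G (n + 1)) :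
    𝒢.IsMultiplicative α ↔ ∀ g h : G, 𝒢.src g = 𝒢.tgt h → ∀ X Y : Fin n → EG,
      (∀ i, 𝒢.Tsrc g (X i) = 𝒢.Ttgt h (Y i)) → ∀ U V : EG, 𝒢.Tsrc g U = 𝒢.Ttgt h V →
      α.sharpAt (𝒢.mul g h) (fun i => 𝒢.Tmul g h (X i, Y i)) (𝒢.Tmul g h (U, V)) =
        α.sharpAt g X U + α.sharpAt h Y V := by
  rw [isMultiplicative_iff]
  constructor
  · intro H g h hgh X Y hXY U V hUV
    have h1 := H g h hgh (Fin.snoc (α := fun _ => EG) X U) (Fin.snoc (α := fun _ => EG) Y V) (by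
      intro i
      refine Fin.lastCases ?_ (fun j => ?_) i
      · simpa using hUV
      · simpa using hXY j)
    rw [α.sharpAt_apply, α.sharpAt_apply, α.sharpAt_apply]
    refine Eq.trans (congrArg (α.toFun (𝒢.mul g h)) (funext fun i => ?_)) h1
    refine Fin.lastCases ?_ (fun j => ?_) i
    · rw [Fin.snoc_last, Fin.snoc_last, Fin.snoc_last]
    · rw [Fin.snoc_castSucc, Fin.snoc_castSucc, Fin.snoc_castSucc]
  · intro H g h hgh X Y hXY
    have h1 := H g h hgh (fun i => X i.castSucc) (fun i => Y i.castSucc) (fun i => hXY _)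
      (X (Fin.last n)) (Y (Fin.last n)) (hXY _)
    rw [α.sharpAt_apply, α.sharpAt_apply, α.sharpAt_apply] at h1
    have e : ∀ Z : Fin (n + 1) → EG,
        Fin.snoc (α := fun _ => EG) (fun i => Z i.castSucc) (Z (Fin.last n)) = Z :=
      fun Z => Fin.snoc_init_self Z
    have e1 := e fun i => 𝒢.Tmul g h (X i, Y i)
    refine (congrArg (α.toFun (𝒢.mul g h)) e1).symm.trans (h1.trans ?_)
    exact congrArg₂ (· + ·) (congrArg (α.toFun g) (e X)) (congrArg (α.toFun h) (e Y))

/-- For a multiplicative form, the source of `α♯ (X₁, …, Xₙ)` only depends on the `Ts Xᵢ`. -/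
theorem srcCov_sharpAt (hα : 𝒢.IsMultiplicative α) (g : G) (X : Fin n → EG) {u : EG}
    (hu : u ∈ 𝒢.algebroidFibre (𝒢.src g)) :
    𝒢.srcCov g (α.sharpAt g X) ⟨u, hu⟩ =
      α.sharpAt (𝒢.one (𝒢.src g)) (fun i => 𝒢.Tone (𝒢.src g) (𝒢.Tsrc g (X i))) u := by
  obtain ⟨U, hU⟩ := 𝒢.Tsrc_surjective g (𝒢.Ttgt (𝒢.one (𝒢.src g)) u)
  have h1 := (𝒢.isMultiplicative_iff_sharpAt α).1 hα g (𝒢.one (𝒢.src g)) (𝒢.tgt_one _).symm X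
    (fun i => 𝒢.Tone (𝒢.src g) (𝒢.Tsrc g (X i))) (fun i => (𝒢.Ttgt_Tone _ _).symm) U u hU
  simp only [Tmul_Tone, 𝒢.mul_one] at h1
  rw [𝒢.srcCov_apply hu hU, h1, add_sub_cancel_left]

/-- For a multiplicative form, the target of `α♯ (X₁, …, Xₙ)` only depends on the `Tt Xᵢ`. -/
theorem tgtCov_sharpAt (hα : 𝒢.IsMultiplicative α) (g : G) (X : Fin n → EG) {v : EG}
    (hv : v ∈ 𝒢.algebroidFibre (𝒢.tgt g)) :
    𝒢.tgtCov g (α.sharpAt g X) ⟨v, hv⟩ =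
      α.sharpAt (𝒢.one (𝒢.tgt g)) (fun i => 𝒢.Tone (𝒢.tgt g) (𝒢.Ttgt g (X i))) v := by
  have h1 := (𝒢.isMultiplicative_iff_sharpAt α).1 hα (𝒢.one (𝒢.tgt g)) g (𝒢.src_one _)
    (fun i => 𝒢.Tone (𝒢.tgt g) (𝒢.Ttgt g (X i))) X (fun i => 𝒢.Tsrc_Tone _ _) v 0
    (by rw [map_zero]; exact hv)
  simp only [Tone_Tmul, 𝒢.one_mul, map_zero, add_zero] at h1
  rw [tgtCov_apply, h1]

/-- A multiplicative form vanishes on vectors tangent to the units. -/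
theorem sharpAt_Tone (hα : 𝒢.IsMultiplicative α) (x : M) (Z : Fin n → EM) (W : EM) :
    α.sharpAt (𝒢.one x) (fun i => 𝒢.Tone x (Z i)) (𝒢.Tone x W) = 0 := by
  have h1 := (𝒢.isMultiplicative_iff_sharpAt α).1 hα (𝒢.one x) (𝒢.one x)
    ((𝒢.src_one x).trans (𝒢.tgt_one x).symm)
    (fun i => 𝒢.Tone x (Z i)) (fun i => 𝒢.Tone x (Z i))
    (fun i => (𝒢.Tsrc_Tone _ _).trans (𝒢.Ttgt_Tone _ _).symm) (𝒢.Tone x W) (𝒢.Tone x W)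
    ((𝒢.Tsrc_Tone _ _).trans (𝒢.Ttgt_Tone _ _).symm)
  have e : ∀ V : EM, 𝒢.Tmul (𝒢.one x) (𝒢.one x) (𝒢.Tone x V, 𝒢.Tone x V) = 𝒢.Tone x V := by
    intro V
    have h2 := 𝒢.Tmul_Tone (𝒢.one x) (𝒢.Tone x V)
    rwa [Tsrc_Tone, 𝒢.src_one] at h2
  have e1 : 𝒢.mul (𝒢.one x) (𝒢.one x) = 𝒢.one x := by
    have h2 := 𝒢.mul_one (𝒢.one x)
    rwa [𝒢.src_one] at h2
  -- Now `h1` reads `c = c + c`.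
  simp only [e, e1] at h1
  exact left_eq_add.1 h1

/-- The map `⊕ⁿ TM → A*` underlying `α♯`: the restriction to the Lie algebroid of
`α (T1 Z₁, …, T1 Zₙ, ·)`. -/
noncomputable def sharpBase (α : DifferentialForm EG G (n + 1))
    (z : Σ x : M, Fin n → TangentSpace 𝓘(ℝ, EM) x) : Σ x : M, 𝒢.algebroidFibre x →L[ℝ] ℝ :=
  ⟨z.1, α.sharpAt (𝒢.one z.1) (fun i => 𝒢.Tone z.1 (z.2 i)) ∘L
    (𝒢.algebroidFibre z.1).subtypeL⟩

theorem isMorphism_sharp (hα : 𝒢.IsMultiplicative α) :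
    (𝒢.tangentGroupoid n).IsMorphism 𝒢.cotangentGroupoid α.sharp := by
  have hs : ∀ a, 𝒢.cotangentSrc (α.sharp a) = 𝒢.sharpBase α ((𝒢.tangentGroupoid n).src a) :=
    fun a => 𝒢.dualAlgebroid_ext rfl fun v hv hv' => 𝒢.srcCov_sharpAt hα a.1 a.2 hv
  have ht : ∀ a, 𝒢.cotangentTgt (α.sharp a) = 𝒢.sharpBase α ((𝒢.tangentGroupoid n).tgt a) :=
    fun a => 𝒢.dualAlgebroid_ext rfl fun v hv hv' => 𝒢.tgtCov_sharpAt hα a.1 a.2 hv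
  refine ⟨𝒢.sharpBase α, hs, ht, fun z => cotangent_ext rfl fun W => ?_, fun a b hab => ?_⟩
  · -- The unit in `T*G` is the extension by zero on `T_x M`, where `α♯ (T1 Z)` vanishes.
    have h2 := map_sub (α.sharpAt (𝒢.one z.1) fun i => 𝒢.Tone z.1 (z.2 i)) W
      (𝒢.Tone z.1 (𝒢.Tsrc (𝒢.one z.1) W))
    have h1 := 𝒢.sharpAt_Tone hα z.1 z.2 (𝒢.Tsrc (𝒢.one z.1) W)
    exact (h2.trans ((congrArg _ h1).trans (sub_zero _))).symm
  · have hc : 𝒢.src a.1 = 𝒢.tgt b.1 := congrArg Sigma.fst hab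
    obtain ⟨-, h2⟩ := 𝒢.cotangent_composable
      ((hs a).trans ((congrArg (𝒢.sharpBase α) hab).trans (ht b).symm))
    refine cotangent_ext rfl fun W => ?_
    obtain ⟨U, V, hUV, rfl⟩ := 𝒢.Tmul_surjective hc W
    exact ((𝒢.isMultiplicative_iff_sharpAt α).1 hα a.1 b.1 hc a.2 b.2 (tangentPower_eq hab)
      U V hUV).trans (𝒢.mulCov_apply hc h2 hUV).symm

theorem isMultiplicative_of_isMorphism_sharp
    (H : (𝒢.tangentGroupoid n).IsMorphism 𝒢.cotangentGroupoid α.sharp) :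
    𝒢.IsMultiplicative α := by
  obtain ⟨f, hs, ht, -, hm⟩ := H
  refine (𝒢.isMultiplicative_iff_sharpAt α).2 fun g h hgh X Y hXY U V hUV => ?_
  let a : Σ g : G, Fin n → TangentSpace 𝓘(ℝ, EG) g := ⟨g, X⟩
  let b : Σ g : G, Fin n → TangentSpace 𝓘(ℝ, EG) g := ⟨h, Y⟩
  have hab : (𝒢.tangentGroupoid n).src a = (𝒢.tangentGroupoid n).tgt b :=
    tangentPower_ext hgh hXY
  obtain ⟨-, h2⟩ := 𝒢.cotangent_composable
    ((hs a).trans ((congrArg f hab).trans (ht b).symm))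
  have h3 : ∀ {c d : Σ g : G, TangentSpace 𝓘(ℝ, EG) g →L[ℝ] ℝ}, c = d → ∀ W : EG,
      (c.2 : EG →L[ℝ] ℝ) W = (d.2 : EG →L[ℝ] ℝ) W := by
    rintro c _ rfl W
    rfl
  exact (h3 (hm a b hab) (𝒢.Tmul g h (U, V))).trans (𝒢.mulCov_apply hgh h2 hUV)

end LieGroupoid

theorem mainTheorem7 {EG EM G M : Type*} [NormedAddCommGroup EG] [NormedSpace ℝ EG]
    [FiniteDimensional ℝ EG] [NormedAddCommGroup EM] [NormedSpace ℝ EM] [FiniteDimensional ℝ EM]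
    [TopologicalSpace G] [ChartedSpace EG G] [IsManifold 𝓘(ℝ, EG) ∞ G]
    [TopologicalSpace M] [ChartedSpace EM M] [IsManifold 𝓘(ℝ, EM) ∞ M]
    (𝒢 : LieGroupoid EG EM G M) (n : ℕ) (α : DifferentialForm EG G (n + 1)) :
    𝒢.IsMultiplicative α ↔
      (𝒢.tangentGroupoid n).IsMorphism 𝒢.cotangentGroupoid α.sharp :=
  ⟨𝒢.isMorphism_sharp, 𝒢.isMultiplicative_of_isMorphism_sharp⟩
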